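/- Let $L\ge 1$, and let $\gamma_1,\dots,\gamma_L$ be independent real random variables, where $\gamma_\ell$ has the Fisher–Snedecor $\mathcal F$ distribution with parameters $\bar\gamma_\ell,m_\ell,m_{s_\ell}>0$, that is, the density $$f_{\gamma_\ell}(x)=\frac{m_\ell^{m_\ell}(m_{s_\ell}\bar\gamma_\ell)^{m_{s_\ell}}}{B(m_\ell,m_{s_\ell})}\,\frac{x^{m_\ell-1}}{(m_\ell x+m_{s_\ell}\bar\gamma_\ell)^{m_\ell+m_{s_\ell}}}\quad(x>0),\qquad f_{\gamma_\ell}(x)=0\quad(x\le 0),$$ with $B$ the beta function. For $c>0$ let $F_B^{(L)}(a_1,\dots,a_L,b_1,\dots,b_L;c;x_1,\dots,x_L)$ denote the Lauricella function: the sum of the series $$\sum_{n_1,\dots,n_L\ge 0}\frac{\prod_{i}(a_i)_{n_i}(b_i)_{n_i}}{(c)_{n_1+\dots+n_L}}\prod_{i}\frac{x_i^{n_i}}{n_i!}\qquad\bigl((q)_k=q(q+1)\cdots(q+k-1)\bigr)$$ for $\max_i|x_i|<1$, and its (unique) holomorphic continuation to $(\mathbb C\setminus[1,\infty))^L$ otherwise.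 Put $S=\sum_{\ell=1}^L m_\ell$ and $$C=\prod_{\ell=1}^L\Bigl(\frac{m_\ell}{m_{s_\ell}\bar\gamma_\ell}\Bigr)^{m_\ell}\frac{\Gamma(m_\ell+m_{s_\ell})}{\Gamma(m_{s_\ell})},\qquad \Phi_c(x)=F_B^{(L)}\Bigl(m_1+m_{s_1},\dots,m_L+m_{s_L},m_1,\dots,m_L;c;-\frac{m_1x}{m_{s_1}\bar\gamma_1},\dots,-\frac{m_Lx}{m_{s_L}\bar\gamma_L}\Bigr).$$ Then, for the parameters $a_\ell=m_\ell+m_{s_\ell}$, $b_\ell=m_\ell$ and $c\in\{S,1+S\}$, the series converges absolutely on the open unit polydisc and the holomorphic continuation exists. The sum $\gamma=\sum_{\ell=1}^L\gamma_\ell$ is absolutely continuous; it has the PDF $$f_\gamma(x)=\frac{x^{S-1}}{\Gamma(S)}\,C\,\Phi_{S}(x),\qquad x\ge 0,$$ and $f_\gamma(x)=0$ for $x<0$ (the value at the single point $x=0$ being immaterial), and the CDF $$F_\gamma(x)=\frac{x^{S}}{\Gamma(1+S)}\,C\,\Phi_{1+S}(x),\qquad x\ge 0.$$ For $x\ge0$,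 the series that define $\Phi_S(x)$ and $\Phi_{1+S}(x)$ both converge absolutely, with sums $\Phi_S(x)$ and $\Phi_{1+S}(x)$, if $\bigl|\frac{m_\ell x}{m_{s_\ell}\bar\gamma_\ell}\bigr|<1$ for every $\ell$; neither of them converges absolutely if $\bigl|\frac{m_\ell x}{m_{s_\ell}\bar\gamma_\ell}\bigr|>1$ for some $\ell$. -/

import Mathlib

open MeasureTheory ProbabilityTheory

noncomputable section

/-- The term of index `n = (n₁, …, n_L)` of the Lauricella series `F_B^{(L)}(a; b; c; x)`, that is,
`∏ (aᵢ)_{nᵢ} (bᵢ)_{nᵢ} / (c)_{n₁ + … + n_L} * ∏ xᵢ ^ nᵢ / nᵢ!`, with Pochhammer symbols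
(rising factorials) `(q)_k`. -/
def lauricellaFBTerm {L : ℕ} (a b : Fin L → ℝ) (c : ℝ) (x : Fin L → ℂ) (n : Fin L → ℕ) : ℂ :=
  (((∏ i, (ascPochhammer ℝ (n i)).eval (a i) * (ascPochhammer ℝ (n i)).eval (b i))
      / (ascPochhammer ℝ (∑ i, n i)).eval c : ℝ) : ℂ)
    * ∏ i, x i ^ n i / (Nat.factorial (n i) : ℂ)

/-- The domain `(ℂ ∖ [1, ∞))^L`. -/
def lauricellaFBDomain (L : ℕ) : Set (Fin L → ℂ) :=
  {x | ∀ i, 1 - x i ∈ Complex.slitPlane}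

/-- `F` is the Lauricella function `F_B^{(L)}(a; b; c; ·)` on `(ℂ ∖ [1, ∞))^L`: it is the sum of the
Lauricella series on the open unit polydisc, continued holomorphically. -/
structure IsLauricellaFB {L : ℕ} (a b : Fin L → ℝ) (c : ℝ) (F : (Fin L → ℂ) → ℂ) : Prop where
  hasSum : ∀ x : Fin L → ℂ, (∀ i, ‖x i‖ < 1) → HasSum (lauricellaFBTerm a b c x) (F x)
  differentiableOn : DifferentiableOn ℂ F (lauricellaFBDomain L)

/-- The continuation is unique on `(ℂ ∖ [1, ∞))^L`. -/
theorem IsLauricellaFB.eqOn {L : ℕ} {a b : Fin L → ℝ} {c : ℝ} {F G : (Fin L → ℂ) → ℂ}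
    (hF : IsLauricellaFB a b c F) (hG : IsLauricellaFB a b c G) :
    Set.EqOn F G (lauricellaFBDomain L) := by
  intro x hx
  have hU : IsOpen {z : ℂ | ∀ i, 1 - z * x i ∈ Complex.slitPlane} := by
    rw [Set.ofPred_forall]
    exact isOpen_iInter_of_finite fun i =>
      Complex.isOpen_slitPlane.preimage (by fun_prop)
  have hstar : StarConvex ℝ (0 : ℂ) {z : ℂ | ∀ i, 1 - z * x i ∈ Complex.slitPlane} := by
    rw [starConvex_zero_iff]
    intro z hz t ht0 ht1 i
    have := Complex.starConvex_one_slitPlane (hz i) (a := 1 - t) (b := t) (by linarith) ht0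
      (by ring)
    convert this using 1
    simp only [Complex.real_smul]
    push_cast
    ring
  have h0 : (0 : ℂ) ∈ {z : ℂ | ∀ i, 1 - z * x i ∈ Complex.slitPlane} := by
    show ∀ i, 1 - 0 * x i ∈ Complex.slitPlane
    simp
  have hconn : IsPreconnected {z : ℂ | ∀ i, 1 - z * x i ∈ Complex.slitPlane} :=
    (hstar.isPathConnected h0).isConnected.isPreconnected
  have hmaps : Set.MapsTo (fun z : ℂ => fun i => z * x i)
      {z : ℂ | ∀ i, 1 - z * x i ∈ Complex.slitPlane} (lauricellaFBDomain L) := fun z hz => hz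
  have hline : ∀ H : (Fin L → ℂ) → ℂ, DifferentiableOn ℂ H (lauricellaFBDomain L) →
      AnalyticOnNhd ℂ (fun z : ℂ => H (fun i => z * x i))
        {z : ℂ | ∀ i, 1 - z * x i ∈ Complex.slitPlane} := fun H hH =>
    (DifferentiableOn.comp hH (by fun_prop) hmaps).analyticOnNhd hU
  have hev : (fun z : ℂ => F (fun i => z * x i)) =ᶠ[nhds 0] fun z : ℂ => G (fun i => z * x i) := by
    have hsm : ∀ᶠ z : ℂ in nhds 0, ∀ i, ‖z * x i‖ < 1 := by
      rw [Filter.eventually_all]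
      intro i
      have hc : Continuous fun z : ℂ => ‖z * x i‖ := by fun_prop
      exact hc.continuousAt.eventually_lt continuousAt_const (by simp)
    filter_upwards [hsm] with z hz
    exact (hF.hasSum _ hz).unique (hG.hasSum _ hz)
  have := (hline F hF.differentiableOn).eqOn_of_preconnected_of_eventuallyEq
    (hline G hG.differentiableOn) hconn h0 hev (x := 1) (by simpa [lauricellaFBDomain] using hx)
  simpa using this

open Classical in
/-- The Lauricella function `F_B^{(L)}(a; b; c; x)` for `x ∈ (ℂ ∖ [1, ∞))^L`. -/
def lauricellaFB {L : ℕ} (a b : Fin L → ℝ) (c : ℝ) : (Fin L → ℂ) → ℂ :=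
  if h : ∃ F, IsLauricellaFB a b c F then h.choose else 0

/-- The density of the Fisher–Snedecor `F` distribution with parameters `(γbar, m, ms)`. -/
def fisherSnedecorPDF (γbar m ms x : ℝ) : ℝ :=
  if 0 < x then
    m ^ m * (ms * γbar) ^ ms / beta m ms * (x ^ (m - 1) / (m * x + ms * γbar) ^ (m + ms))
  else 0

/-- The Fisher–Snedecor `F` distribution with parameters `(γbar, m, ms)`. -/
def fisherSnedecorMeasure (γbar m ms : ℝ) : Measure ℝ :=
  volume.withDensity fun x => ENNReal.ofReal (fisherSnedecorPDF γbar m ms x)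

end

/-! Each Fisher–Snedecor density is `t ^ (m - 1)` times a constant multiple of `(1 + m / (ms * γbar)
* t) ^ (-(m + ms))`. By independence the vector of the summands has a product density against
`piPowMeasure m`, which is homogeneous of degree `S = ∑ mᵢ`.

Homogeneity splits this measure in polar coordinates `u = t • w`, `t = ∑ uᵢ`, into `t ^ (S - 1) dt`
times `dirichletMeasure m` (`piPowMeasure_map_polar`). So the sum has density `t ^ (S - 1) * ∫ ∏
fisherSnedecorFactor (t • w)` over `dirichletMeasure m`. The dilation `u = x • w` gives the CDF as
`x ^ S` times the same integral over `solidDirichletMeasure m`.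

Both integrals are instances of `∫ ∏ (1 - uᵢ xᵢ) ^ (-aᵢ) ∂ρ`, where the moments of `ρ` are `∏ Γ(mᵢ +
nᵢ) / Γ(c + ∑ nᵢ)`: `c = S` for the simplex and `c = 1 + S` for the solid simplex. For any such `ρ`,
expanding the kernel in binomial series and integrating termwise gives the Lauricella series up to a
constant, and differentiating under the integral gives the holomorphic continuation
(`isLauricellaFB_integral_lauricellaKernel`). Uniqueness of the continuation then identifies the
integrals with `lauricellaFB` for every `x ≥ 0`, also beyond the polydisc. Divergence is visible on
a single axis of indices, by the ratio test. -/

noncomputable section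

/-! ### Power measures on the half-line -/

/-- The measure `t ^ (p - 1) dt` on the positive half-line. -/
def powMeasure (p : ℝ) : Measure ℝ :=
  (volume.restrict (Set.Ioi 0)).withDensity fun t => ENNReal.ofReal (t ^ (p - 1))

instance (p : ℝ) : SigmaFinite (powMeasure p) :=
  SigmaFinite.withDensity_ofReal _

theorem powMeasure_ae_pos (p : ℝ) : ∀ᵐ t ∂powMeasure p, 0 < t :=
  (withDensity_absolutelyContinuous _ _).ae_le (ae_restrict_mem measurableSet_Ioi)

theorem lintegral_powMeasure (p : ℝ) (f : ℝ → ENNReal) (hf : Measurable f) :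
    ∫⁻ t, f t ∂powMeasure p = ∫⁻ t in Set.Ioi 0, ENNReal.ofReal (t ^ (p - 1)) * f t := by
  rw [powMeasure, lintegral_withDensity_eq_lintegral_mul _ (by fun_prop) hf]
  rfl

/-- Homogeneity of degree `p`: the substitution `y = c * t` contributes `c⁻¹` from Lebesgue measure
and `c ^ (1 - p)` from the density. -/
theorem powMeasure_preimage_mul (p : ℝ) {c : ℝ} (hc : 0 < c) {s : Set ℝ} (hs : MeasurableSet s) :
    powMeasure p ((fun t => c * t) ⁻¹' s) = ENNReal.ofReal (c ^ (-p)) * powMeasure p s := by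
  have hms : MeasurableSet ((fun t => c * t) ⁻¹' s) := hs.preimage (by fun_prop)
  rw [← lintegral_indicator_one hms, ← lintegral_indicator_one hs,
    lintegral_powMeasure _ _ (measurable_one.indicator hms),
    lintegral_powMeasure _ _ (measurable_one.indicator hs)]
  -- Extension by zero, so that the substitution takes place on all of `ℝ`, where Lebesgue measure
  -- scales.
  set g : ℝ → ENNReal := (Set.Ioi 0).indicator fun y =>
    ENNReal.ofReal (y ^ (p - 1)) * s.indicator 1 y
  have hg : Measurable g :=
    Measurable.indicator (by
      exact Measurable.mul (by fun_prop) (measurable_one.indicator hs)) measurableSet_Ioi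
  have hscale : ∀ t, (Set.Ioi 0).indicator (fun y => ENNReal.ofReal (y ^ (p - 1)) *
      ((fun t => c * t) ⁻¹' s).indicator 1 y) t = ENNReal.ofReal (c ^ (1 - p)) * g (c * t) := by
    intro t
    by_cases ht : 0 < t
    · have hct : 0 < c * t := mul_pos hc ht
      have h1 : t ^ (p - 1) = c ^ (1 - p) * (c * t) ^ (p - 1) := by
        rw [Real.mul_rpow hc.le ht.le, ← mul_assoc, ← Real.rpow_add hc]
        simp
      simp only [g, Set.indicator_of_mem (Set.mem_Ioi.2 ht), Set.indicator_of_mem (Set.mem_Ioi.2 hct)]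
      rw [h1, ENNReal.ofReal_mul (by positivity), mul_assoc]
      rfl
    · have hct : ¬ 0 < c * t := by simpa [hc] using ht
      simp [g, Set.indicator_of_notMem (show t ∉ Set.Ioi 0 from ht),
        Set.indicator_of_notMem (show c * t ∉ Set.Ioi 0 from hct)]
  rw [← lintegral_indicator measurableSet_Ioi, ← lintegral_indicator measurableSet_Ioi]
  simp_rw [hscale]
  rw [lintegral_const_mul _ (by fun_prop), ← lintegral_map (g := fun t => c * t) hg (by fun_prop),
    Real.map_volume_mul_left hc.ne', lintegral_smul_measure, smul_eq_mul, ← mul_assoc,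
    ← ENNReal.ofReal_mul (by positivity), abs_of_pos (by positivity)]
  congr 2
  rw [← Real.rpow_neg_one c, ← Real.rpow_add hc]
  ring_nf

theorem powMeasure_Iic {p t : ℝ} (hp : 0 < p) (ht : 0 ≤ t) :
    powMeasure p (Set.Iic t) = ENNReal.ofReal (t ^ p / p) := by
  rw [powMeasure, withDensity_apply _ measurableSet_Iic, Measure.restrict_restrict measurableSet_Iic,
    Set.inter_comm, Set.Ioi_inter_Iic, ← ofReal_integral_eq_lintegral_ofReal]
  · rw [← intervalIntegral.integral_of_le ht, integral_rpow (Or.inl (by linarith))]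
    simp [Real.zero_rpow hp.ne']
  · exact (intervalIntegrable_iff_integrableOn_Ioc_of_le ht).1
      (intervalIntegral.intervalIntegrable_rpow' (by linarith))
  · filter_upwards [ae_restrict_mem measurableSet_Ioc] with x hx
    exact Real.rpow_nonneg hx.1.le _

/-- A monomial weight only shifts the exponent, so every radial moment is a total mass for another
parameter. -/
theorem powMeasure_withDensity_pow (p : ℝ) (n : ℕ) :
    (powMeasure p).withDensity (fun t => ENNReal.ofReal t ^ n) = powMeasure (p + n) := by
  rw [powMeasure, ← withDensity_mul _ (by fun_prop) (by fun_prop), powMeasure]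
  refine withDensity_congr_ae ?_
  filter_upwards [ae_restrict_mem measurableSet_Ioi] with t ht
  have ht : 0 < t := ht
  rw [Pi.mul_apply, ← ENNReal.ofReal_pow ht.le, ← ENNReal.ofReal_mul (by positivity),
    ← Real.rpow_natCast t n, ← Real.rpow_add ht]
  ring_nf

theorem lintegral_exp_neg_powMeasure {p : ℝ} (hp : 0 < p) :
    ∫⁻ t, ENNReal.ofReal (Real.exp (-t)) ∂powMeasure p = ENNReal.ofReal (Real.Gamma p) := by
  rw [lintegral_powMeasure _ _ (by fun_prop), Real.Gamma_eq_integral hp,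
    ofReal_integral_eq_lintegral_ofReal (Real.GammaIntegral_convergent hp)]
  · refine setLIntegral_congr_fun measurableSet_Ioi fun t ht => ?_
    have ht : 0 < t := ht
    rw [← ENNReal.ofReal_mul (by positivity), mul_comm]
  · filter_upwards [ae_restrict_mem measurableSet_Ioi] with t ht
    have ht : 0 < t := ht
    simp only [Pi.zero_apply]
    positivity

theorem lintegral_pow_mul_exp_neg_powMeasure {p : ℝ} (hp : 0 < p) (n : ℕ) :
    ∫⁻ t, ENNReal.ofReal t ^ n * ENNReal.ofReal (Real.exp (-t)) ∂powMeasure p =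
      ENNReal.ofReal (Real.Gamma (p + n)) := by
  rw [← lintegral_exp_neg_powMeasure (p := p + n) (by positivity), ← powMeasure_withDensity_pow,
    lintegral_withDensity_eq_lintegral_mul _ (by fun_prop) (by fun_prop)]
  rfl

/-! ### Product densities on finite products -/

/-- Tonelli's theorem for a product of functions of separate coordinates. -/
theorem lintegral_fin_prod_eq_prod {n : ℕ} {E : Fin n → Type*} {mE : ∀ i, MeasurableSpace (E i)}
    {μ : (i : Fin n) → Measure (E i)} [∀ i, SigmaFinite (μ i)] (f : (i : Fin n) → E i → ENNReal)
    (hf : ∀ i, Measurable (f i)) :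
    ∫⁻ x : (i : Fin n) → E i, ∏ i, f i (x i) ∂(Measure.pi μ) = ∏ i, ∫⁻ x, f i x ∂(μ i) := by
  induction n with
  | zero => simp
  | succ n n_ih =>
      have h := (measurePreserving_piFinSuccAbove μ 0).symm
      have hm : Measurable fun x : (i : Fin (n + 1)) → E i => ∏ i, f i (x i) :=
        Finset.measurable_prod _ fun i _ => (hf i).comp (measurable_pi_apply i)
      rw [← h.lintegral_comp hm, Fin.prod_univ_succ,
        ← n_ih (fun i => f i.succ) (fun i => hf _),
        ← lintegral_prod_mul (hf 0).aemeasurable (Finset.measurable_prod _ fun i _ =>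
          (hf i.succ).comp (measurable_pi_apply i)).aemeasurable]
      refine lintegral_congr fun x => ?_
      rw [Fin.prod_univ_succ]
      rfl

/-- On a box the indicator factors over the coordinates, which reduces the claim to Tonelli. It
turns independence into a joint density. -/
theorem pi_withDensity {n : ℕ} {E : Fin n → Type*} {mE : ∀ i, MeasurableSpace (E i)}
    {μ : (i : Fin n) → Measure (E i)} [∀ i, SigmaFinite (μ i)] (f : (i : Fin n) → E i → ENNReal)
    (hf : ∀ i, Measurable (f i)) [∀ i, SigmaFinite ((μ i).withDensity (f i))] :
    Measure.pi (fun i => (μ i).withDensity (f i)) =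
      (Measure.pi μ).withDensity fun x => ∏ i, f i (x i) := by
  refine Measure.pi_eq fun s hs => ?_
  rw [withDensity_apply _ (.univ_pi hs), ← lintegral_indicator (.univ_pi hs)]
  have h : ∀ x : (i : Fin n) → E i, (Set.univ.pi s).indicator (fun x => ∏ i, f i (x i)) x =
      ∏ i, (s i).indicator (f i) (x i) := by
    intro x
    by_cases hx : x ∈ Set.univ.pi s
    · rw [Set.indicator_of_mem hx]
      exact Finset.prod_congr rfl fun i _ => (Set.indicator_of_mem (hx i trivial) _).symm
    · rw [Set.indicator_of_notMem hx]
      simp only [Set.mem_pi, Set.mem_univ, true_imp_iff, not_forall] at hx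
      obtain ⟨i, hi⟩ := hx
      exact (Finset.prod_eq_zero (Finset.mem_univ i) (Set.indicator_of_notMem hi _)).symm
  simp_rw [h]
  rw [lintegral_fin_prod_eq_prod _ fun i => (hf i).indicator (hs i)]
  refine Finset.prod_congr rfl fun i _ => ?_
  rw [lintegral_indicator (hs i), withDensity_apply _ (hs i)]

/-! ### Homogeneity, polar coordinates and Dirichlet measures -/

section

variable {L : ℕ} (m : Fin L → ℝ)

/-- The measure `∏ uᵢ ^ (mᵢ - 1) du` on the positive orthant. -/
def piPowMeasure : Measure (Fin L → ℝ) := Measure.pi fun i => powMeasure (m i)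

theorem piPowMeasure_ae_pos : ∀ᵐ u ∂piPowMeasure m, ∀ i, 0 < u i :=
  ae_all_iff.2 fun i =>
    (Measure.quasiMeasurePreserving_eval (fun i => powMeasure (m i)) i).ae (powMeasure_ae_pos (m i))

/-- The one-dimensional scaling factors multiply to `c ^ (-∑ mᵢ)` on boxes, and boxes determine a
product measure. -/
theorem piPowMeasure_eq_smul_map {c : ℝ} (hc : 0 < c) :
    piPowMeasure m =
      ENNReal.ofReal (c ^ ∑ i, m i) • (piPowMeasure m).map (fun u => c • u) := by
  refine Measure.pi_eq fun s hs => ?_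
  have hpre : (fun u : Fin L → ℝ => c • u) ⁻¹' Set.univ.pi s =
      Set.univ.pi fun i => (fun t => c * t) ⁻¹' s i := by
    ext u; simp [Set.mem_pi]
  rw [Measure.smul_apply, Measure.map_apply (by fun_prop) (.univ_pi hs), hpre, piPowMeasure,
    Measure.pi_pi, smul_eq_mul]
  simp only [powMeasure_preimage_mul _ hc (hs _), Finset.prod_mul_distrib]
  rw [← mul_assoc, ← ENNReal.ofReal_prod_of_nonneg fun i _ => by positivity,
    ← ENNReal.ofReal_mul (by positivity), ← Real.rpow_sum_of_pos hc, ← Real.rpow_add hc]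
  simp

theorem lintegral_piPowMeasure_smul {c : ℝ} (hc : 0 < c) {f : (Fin L → ℝ) → ENNReal}
    (hf : Measurable f) :
    ∫⁻ u, f u ∂piPowMeasure m =
      ENNReal.ofReal (c ^ ∑ i, m i) * ∫⁻ u, f (c • u) ∂piPowMeasure m := by
  conv_lhs => rw [piPowMeasure_eq_smul_map m hc]
  rw [lintegral_smul_measure, lintegral_map hf (by fun_prop), smul_eq_mul]

variable {m}

theorem lintegral_prod_pow_mul_exp_neg_sum_piPowMeasure (hm : ∀ i, 0 < m i) (n : Fin L → ℕ) :
    ∫⁻ u, (∏ i, ENNReal.ofReal (u i) ^ n i) * ENNReal.ofReal (Real.exp (-∑ i, u i))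
      ∂piPowMeasure m = ENNReal.ofReal (∏ i, Real.Gamma (m i + n i)) := by
  have h : ∀ u : Fin L → ℝ, (∏ i, ENNReal.ofReal (u i) ^ n i) *
      ENNReal.ofReal (Real.exp (-∑ i, u i)) =
      ∏ i, (ENNReal.ofReal (u i) ^ n i * ENNReal.ofReal (Real.exp (-u i))) := by
    intro u
    rw [Finset.prod_mul_distrib, ← Finset.sum_neg_distrib, Real.exp_sum,
      ENNReal.ofReal_prod_of_nonneg fun i _ => (Real.exp_pos _).le]
  simp_rw [h]
  rw [piPowMeasure, lintegral_fin_prod_eq_prod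
    (fun i t => ENNReal.ofReal t ^ n i * ENNReal.ofReal (Real.exp (-t))) (fun i => by fun_prop),
    ENNReal.ofReal_prod_of_nonneg fun i _ =>
      (Real.Gamma_pos_of_pos (add_pos_of_pos_of_nonneg (hm i) (Nat.cast_nonneg _))).le]
  exact Finset.prod_congr rfl fun i _ => lintegral_pow_mul_exp_neg_powMeasure (hm i) _

/-- Markov's inequality: `exp (-∑ uᵢ)` has finite integral `∏ Γ(mᵢ)` and is at least `exp (-1)` on
this set. -/
theorem piPowMeasure_sum_le_one_lt_top (hm : ∀ i, 0 < m i) :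
    piPowMeasure m {u | ∑ i, u i ≤ 1} < ⊤ := by
  have h := lintegral_prod_pow_mul_exp_neg_sum_piPowMeasure hm fun _ => 0
  simp only [pow_zero, Finset.prod_const_one, one_mul] at h
  have h2 := meas_ge_le_lintegral_div (μ := piPowMeasure m)
    (f := fun u => ENNReal.ofReal (Real.exp (-∑ i, u i))) (by fun_prop)
    (ε := ENNReal.ofReal (Real.exp (-1))) (by simp [Real.exp_pos]) ENNReal.ofReal_ne_top
  rw [h] at h2
  refine lt_of_le_of_lt (measure_mono fun u hu => ?_)
    (h2.trans_lt (ENNReal.div_lt_top ENNReal.ofReal_ne_top (by simp [Real.exp_pos])))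
  have hu : ∑ i, u i ≤ 1 := hu
  exact ENNReal.ofReal_le_ofReal (Real.exp_le_exp.2 (by linarith))

variable (m)

/-- The restriction of `piPowMeasure` to the solid simplex. -/
def solidDirichletMeasure : Measure (Fin L → ℝ) :=
  (piPowMeasure m).restrict {u | ∑ i, u i ≤ 1}

/-- The angular part of `piPowMeasure` in the polar coordinates `(∑ uᵢ, u / ∑ uᵢ)`; a multiple of
the Dirichlet distribution on the simplex. -/
def dirichletMeasure : Measure (Fin L → ℝ) :=
  ENNReal.ofReal (∑ i, m i) • (solidDirichletMeasure m).map fun u => (∑ i, u i)⁻¹ • u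

variable {m}

theorem measurableSet_sum_le (t : ℝ) : MeasurableSet {u : Fin L → ℝ | ∑ i, u i ≤ t} :=
  measurableSet_le (by fun_prop) measurable_const

theorem isFiniteMeasure_solidDirichletMeasure (hm : ∀ i, 0 < m i) :
    IsFiniteMeasure (solidDirichletMeasure m) :=
  ⟨by rw [solidDirichletMeasure, Measure.restrict_apply_univ]
      exact piPowMeasure_sum_le_one_lt_top hm⟩

theorem isFiniteMeasure_dirichletMeasure (hm : ∀ i, 0 < m i) :
    IsFiniteMeasure (dirichletMeasure m) := by
  have := isFiniteMeasure_solidDirichletMeasure hm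
  exact Measure.smul_finite _ ENNReal.ofReal_ne_top

/-- The integral representation uses no more about the support than this: the cube is compact and
its coordinates lie in `[0, 1]`. -/
theorem solidDirichletMeasure_ae_mem_cube :
    ∀ᵐ u ∂solidDirichletMeasure m, u ∈ Set.Icc (0 : Fin L → ℝ) 1 := by
  filter_upwards [ae_restrict_of_ae (piPowMeasure_ae_pos m),
    ae_restrict_mem (measurableSet_sum_le 1)] with u hu hu1
  refine ⟨fun i => (hu i).le, fun i => ?_⟩
  exact (Finset.single_le_sum (fun j _ => (hu j).le) (Finset.mem_univ i)).trans hu1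

theorem dirichletMeasure_ae_mem_cube :
    ∀ᵐ u ∂dirichletMeasure m, u ∈ Set.Icc (0 : Fin L → ℝ) 1 := by
  refine Measure.ae_smul_measure ?_ _
  refine (ae_map_iff (by fun_prop) measurableSet_Icc).2 ?_
  filter_upwards [ae_restrict_of_ae (piPowMeasure_ae_pos m)] with u hu
  have hs : 0 ≤ ∑ j, u j := Finset.sum_nonneg fun j _ => (hu j).le
  refine ⟨fun i => mul_nonneg (inv_nonneg.2 hs) (hu i).le, fun i => ?_⟩
  have hi : u i ≤ ∑ j, u j := Finset.single_le_sum (fun j _ => (hu j).le) (Finset.mem_univ i)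
  have : 0 < ∑ j, u j := (hu i).trans_le hi
  rw [Pi.smul_apply, smul_eq_mul, inv_mul_eq_div]
  exact (div_le_one this).2 hi

/-- Polar coordinates for `piPowMeasure`. -/
theorem piPowMeasure_map_polar (hL : 0 < L) (hm : ∀ i, 0 < m i) :
    (piPowMeasure m).map (fun u => (∑ i, u i, (∑ i, u i)⁻¹ • u)) =
      (powMeasure (∑ i, m i)).prod (dirichletMeasure m) := by
  have : NeZero L := ⟨hL.ne'⟩
  have hS : 0 < ∑ i, m i := Finset.sum_pos (fun i _ => hm i) Finset.univ_nonempty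
  have := isFiniteMeasure_dirichletMeasure hm
  refine (Measure.prod_eq fun A B hA hB => ?_).symm
  set dir : (Fin L → ℝ) → (Fin L → ℝ) := fun u => (∑ i, u i)⁻¹ • u with hdir
  have hdm : Measurable dir := by fun_prop
  have hρB : dirichletMeasure m B = ENNReal.ofReal (∑ i, m i) *
      piPowMeasure m (dir ⁻¹' B ∩ {u | ∑ i, u i ≤ 1}) := by
    rw [dirichletMeasure, Measure.smul_apply, Measure.map_apply hdm hB, solidDirichletMeasure,
      Measure.restrict_apply (hdm hB), smul_eq_mul]
  -- With the set `B` of directions fixed, only a radial measure on `ℝ` has to be identified, and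
  -- the half-lines `Iic t` suffice for that.
  have key : ((piPowMeasure m).restrict (dir ⁻¹' B)).map (fun u => ∑ i, u i) =
      dirichletMeasure m B • powMeasure (∑ i, m i) := by
    have happ : ∀ t : ℝ, ((piPowMeasure m).restrict (dir ⁻¹' B)).map (fun u => ∑ i, u i)
        (Set.Iic t) = piPowMeasure m (dir ⁻¹' B ∩ {u | ∑ i, u i ≤ t}) := by
      intro t
      rw [Measure.map_apply (by fun_prop) measurableSet_Iic,
        Measure.restrict_apply (measurableSet_Iic.preimage (by fun_prop)), Set.inter_comm]
      rfl
    have hIic : ∀ t : ℝ, ((piPowMeasure m).restrict (dir ⁻¹' B)).map (fun u => ∑ i, u i)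
        (Set.Iic t) = (dirichletMeasure m B • powMeasure (∑ i, m i)) (Set.Iic t) := by
      intro t
      rw [happ, Measure.smul_apply, smul_eq_mul]
      rcases le_or_gt t 0 with ht | ht
      · have h0 : powMeasure (∑ i, m i) (Set.Iic t) = 0 :=
          measure_mono_null (Set.Iic_subset_Iic.2 ht) (by
            rw [powMeasure_Iic hS le_rfl, Real.zero_rpow hS.ne']; simp)
        rw [h0, mul_zero]
        refine measure_mono_null (t := {u | ¬ ∀ i, 0 < u i}) (fun u hu hpos => ?_)
          (ae_iff.1 (piPowMeasure_ae_pos m))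
        have h1 : ∑ i, u i ≤ t := hu.2
        have h2 : 0 < ∑ i, u i := Finset.sum_pos (fun i _ => hpos i) Finset.univ_nonempty
        linarith
      -- Dilation preserves directions, so level `t` reduces to level `1` at the cost of `t ^ S`.
      -- The factor `S` in `dirichletMeasure` cancels the denominator of `powMeasure S (Iic t) = t ^
      -- S / S`.
      · have hset : (fun u : Fin L → ℝ => t • u) ⁻¹' (dir ⁻¹' B ∩ {u | ∑ i, u i ≤ t}) =
            dir ⁻¹' B ∩ {u | ∑ i, u i ≤ 1} := by
          ext u
          have h1 : dir (t • u) = dir u := by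
            simp only [hdir, Pi.smul_apply, smul_eq_mul, ← Finset.mul_sum, smul_smul, mul_inv]
            congr 1
            field_simp
          have h2 : ∑ i, (t • u) i ≤ t ↔ ∑ i, u i ≤ 1 := by
            simp only [Pi.smul_apply, smul_eq_mul, ← Finset.mul_sum]
            exact mul_le_iff_le_one_right ht
          simp only [Set.mem_preimage, Set.mem_inter_iff, h1, Set.mem_ofPred_eq, h2]
        rw [piPowMeasure_eq_smul_map m ht, Measure.smul_apply, Measure.map_apply (by fun_prop)
          ((hdm hB).inter (measurableSet_sum_le t)), hset, hρB, powMeasure_Iic hS ht.le,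
          smul_eq_mul, mul_right_comm, ← ENNReal.ofReal_mul hS.le]
        congr 2
        field_simp
    refine Measure.ext_of_generateFrom_of_iUnion (Set.range Set.Iic) (fun n : ℕ => Set.Iic (n : ℝ))
      (borel_eq_generateFrom_Iic ℝ ▸ BorelSpace.measurable_eq) isPiSystem_Iic ?_
      (fun n => ⟨_, rfl⟩) ?_ ?_
    · exact Set.iUnion_eq_univ_iff.2 fun x => exists_nat_ge x
    · intro n
      rw [hIic, Measure.smul_apply, smul_eq_mul, powMeasure_Iic hS (Nat.cast_nonneg n)]
      exact ENNReal.mul_ne_top (measure_ne_top _ _) ENNReal.ofReal_ne_top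
    · rintro _ ⟨t, rfl⟩
      exact hIic t
  have hval := congrArg (fun μ => μ A) key
  simp only [Measure.smul_apply, smul_eq_mul] at hval
  rw [mul_comm, ← hval, Measure.map_apply (by fun_prop) (hA.prod hB),
    Measure.map_apply (by fun_prop) hA, Measure.restrict_apply (hA.preimage (by fun_prop))]
  rfl

/-- The radial factor `g` is separate because it is what changes between uses: `exp (-t)` for the
moments, the indicator of `Iic 1` for the solid simplex, the indicator of a Borel set for the law of
the sum. -/
theorem lintegral_piPowMeasure_polar (hL : 0 < L) (hm : ∀ i, 0 < m i)
    {f : (Fin L → ℝ) → ENNReal} (hf : Measurable f) {g : ℝ → ENNReal} (hg : Measurable g) :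
    ∫⁻ u, g (∑ i, u i) * f u ∂piPowMeasure m =
      ∫⁻ t, g t * ∫⁻ w, f (t • w) ∂dirichletMeasure m ∂powMeasure (∑ i, m i) := by
  have : NeZero L := ⟨hL.ne'⟩
  have := isFiniteMeasure_dirichletMeasure hm
  have h1 : ∫⁻ u, g (∑ i, u i) * f u ∂piPowMeasure m =
      ∫⁻ p, g p.1 * f (p.1 • p.2) ∂(powMeasure (∑ i, m i)).prod (dirichletMeasure m) := by
    rw [← piPowMeasure_map_polar hL hm, lintegral_map (by fun_prop) (by fun_prop)]
    refine lintegral_congr_ae ?_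
    filter_upwards [piPowMeasure_ae_pos m] with u hu
    have h2 : ∑ i, u i ≠ 0 := (Finset.sum_pos (fun i _ => hu i) Finset.univ_nonempty).ne'
    simp only [smul_smul, mul_inv_cancel₀ h2, one_smul]
  rw [h1, lintegral_prod _ (by fun_prop)]
  refine lintegral_congr fun t => ?_
  simp only
  rw [lintegral_const_mul _ (by fun_prop)]

/-! ### Moments of the Dirichlet measures -/

theorem prod_ofReal_smul_pow {t : ℝ} (w : Fin L → ℝ) (ht : 0 ≤ t) (n : Fin L → ℕ) :
    ∏ i, ENNReal.ofReal ((t • w) i) ^ n i =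
      ENNReal.ofReal t ^ (∑ i, n i) * ∏ i, ENNReal.ofReal (w i) ^ n i := by
  simp only [Pi.smul_apply, smul_eq_mul, ENNReal.ofReal_mul ht, mul_pow, Finset.prod_mul_distrib,
    Finset.prod_pow_eq_pow_sum]

/-- The integral of `∏ uᵢ ^ nᵢ * exp (-∑ uᵢ)` is computed twice: coordinatewise it is a product of
Gamma values, in polar coordinates it is `Γ(S + ∑ nᵢ)` times the moment. -/
theorem lintegral_prod_pow_dirichletMeasure (hL : 0 < L) (hm : ∀ i, 0 < m i) (n : Fin L → ℕ) :
    ∫⁻ w, ∏ i, ENNReal.ofReal (w i) ^ n i ∂dirichletMeasure m =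
      ENNReal.ofReal ((∏ i, Real.Gamma (m i + n i)) /
        Real.Gamma (∑ i, m i + ∑ i, (n i : ℝ))) := by
  have : NeZero L := ⟨hL.ne'⟩
  have hS : 0 < ∑ i, m i := Finset.sum_pos (fun i _ => hm i) Finset.univ_nonempty
  have hG : 0 < Real.Gamma (∑ i, m i + ∑ i, (n i : ℝ)) := Real.Gamma_pos_of_pos (by positivity)
  have h1 := lintegral_prod_pow_mul_exp_neg_sum_piPowMeasure hm n
  simp_rw [mul_comm (∏ i, _) (ENNReal.ofReal (Real.exp _))] at h1
  rw [lintegral_piPowMeasure_polar hL hm (f := fun u => ∏ i, ENNReal.ofReal (u i) ^ n i)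
    (g := fun t => ENNReal.ofReal (Real.exp (-t))) (by fun_prop) (by fun_prop)] at h1
  have h2 : ∀ᵐ t ∂powMeasure (∑ i, m i), ENNReal.ofReal (Real.exp (-t)) *
      ∫⁻ w, ∏ i, ENNReal.ofReal ((t • w) i) ^ n i ∂dirichletMeasure m =
      (ENNReal.ofReal t ^ (∑ i, n i) * ENNReal.ofReal (Real.exp (-t))) *
        ∫⁻ w, ∏ i, ENNReal.ofReal (w i) ^ n i ∂dirichletMeasure m := by
    filter_upwards [powMeasure_ae_pos _] with t ht
    simp_rw [prod_ofReal_smul_pow _ ht.le]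
    rw [lintegral_const_mul _ (by fun_prop)]
    ring
  rw [lintegral_congr_ae h2, lintegral_mul_const _ (by fun_prop),
    lintegral_pow_mul_exp_neg_powMeasure hS, Nat.cast_sum] at h1
  rw [ENNReal.ofReal_div_of_pos hG, ENNReal.eq_div_iff (by simpa using hG) ENNReal.ofReal_ne_top, h1]

/-- Integrating the radius over `t ≤ 1` adds a factor `1 / (S + ∑ nᵢ)`, which `Γ(z + 1) = z Γ(z)`
absorbs. This is the origin of `1 + S` in the CDF. -/
theorem lintegral_prod_pow_solidDirichletMeasure (hL : 0 < L) (hm : ∀ i, 0 < m i)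
    (n : Fin L → ℕ) :
    ∫⁻ w, ∏ i, ENNReal.ofReal (w i) ^ n i ∂solidDirichletMeasure m =
      ENNReal.ofReal ((∏ i, Real.Gamma (m i + n i)) /
        Real.Gamma (1 + ∑ i, m i + ∑ i, (n i : ℝ))) := by
  have : NeZero L := ⟨hL.ne'⟩
  have hS : 0 < ∑ i, m i := Finset.sum_pos (fun i _ => hm i) Finset.univ_nonempty
  have h0 : ∫⁻ w, ∏ i, ENNReal.ofReal (w i) ^ n i ∂solidDirichletMeasure m =
      ∫⁻ u, (Set.Iic (1 : ℝ)).indicator 1 (∑ i, u i) * ∏ i, ENNReal.ofReal (u i) ^ n i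
        ∂piPowMeasure m := by
    rw [solidDirichletMeasure, ← lintegral_indicator (measurableSet_sum_le 1)]
    refine lintegral_congr fun u => ?_
    by_cases hu : ∑ i, u i ≤ 1 <;> simp [hu]
  rw [h0, lintegral_piPowMeasure_polar hL hm (f := fun u => ∏ i, ENNReal.ofReal (u i) ^ n i)
    (g := (Set.Iic (1 : ℝ)).indicator 1) (by fun_prop)
    (measurable_one.indicator measurableSet_Iic)]
  have h2 : ∀ᵐ t ∂powMeasure (∑ i, m i), (Set.Iic (1 : ℝ)).indicator 1 t *
      ∫⁻ w, ∏ i, ENNReal.ofReal ((t • w) i) ^ n i ∂dirichletMeasure m =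
      (ENNReal.ofReal t ^ (∑ i, n i) * (Set.Iic (1 : ℝ)).indicator 1 t) *
        ∫⁻ w, ∏ i, ENNReal.ofReal (w i) ^ n i ∂dirichletMeasure m := by
    filter_upwards [powMeasure_ae_pos _] with t ht
    simp_rw [prod_ofReal_smul_pow _ ht.le]
    rw [lintegral_const_mul _ (by fun_prop)]
    ring
  have h3 : ∫⁻ t, ENNReal.ofReal t ^ (∑ i, n i) * (Set.Iic (1 : ℝ)).indicator 1 t
      ∂powMeasure (∑ i, m i) = ENNReal.ofReal (1 / (∑ i, m i + ∑ i, (n i : ℝ))) := by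
    have h4 := powMeasure_Iic (p := ∑ i, m i + (∑ i, n i : ℕ)) (by positivity) zero_le_one
    rw [Real.one_rpow, ← powMeasure_withDensity_pow, ← lintegral_indicator_one measurableSet_Iic,
      lintegral_withDensity_eq_lintegral_mul _ (by fun_prop)
        (measurable_one.indicator measurableSet_Iic), Nat.cast_sum] at h4
    exact h4
  have hmeas : Measurable fun t : ℝ =>
      ENNReal.ofReal t ^ (∑ i, n i) * (Set.Iic (1 : ℝ)).indicator (1 : ℝ → ENNReal) t :=
    Measurable.mul (by fun_prop) (measurable_one.indicator measurableSet_Iic)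
  rw [lintegral_congr_ae h2, lintegral_mul_const _ hmeas, h3,
    lintegral_prod_pow_dirichletMeasure hL hm, ← ENNReal.ofReal_mul (by positivity)]
  congr 1
  rw [add_assoc, add_comm 1, Real.Gamma_add_one (by positivity)]
  field_simp

theorem integral_prod_pow_of_lintegral {ρ : Measure (Fin L → ℝ)}
    (hρ : ∀ᵐ u ∂ρ, u ∈ Set.Icc 0 1) (n : Fin L → ℕ) {r : ℝ} (hr : 0 ≤ r)
    (h : ∫⁻ w, ∏ i, ENNReal.ofReal (w i) ^ n i ∂ρ = ENNReal.ofReal r) :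
    ∫ w, ∏ i, w i ^ n i ∂ρ = r := by
  rw [integral_eq_lintegral_of_nonneg_ae (hρ.mono fun u hu => Finset.prod_nonneg fun i _ =>
    pow_nonneg (hu.1 i) _) (Measurable.aestronglyMeasurable (by fun_prop)), ← ENNReal.toReal_ofReal hr, ← h]
  congr 1
  refine lintegral_congr_ae (hρ.mono fun u hu => ?_)
  simp only
  rw [ENNReal.ofReal_prod_of_nonneg fun i _ => pow_nonneg (hu.1 i) _]
  exact Finset.prod_congr rfl fun i _ => ENNReal.ofReal_pow (hu.1 i) _

theorem integral_prod_pow_dirichletMeasure (hL : 0 < L) (hm : ∀ i, 0 < m i) (n : Fin L → ℕ) :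
    ∫ w, ∏ i, w i ^ n i ∂dirichletMeasure m =
      (∏ i, Real.Gamma (m i + n i)) / Real.Gamma (∑ i, m i + ∑ i, (n i : ℝ)) :=
  integral_prod_pow_of_lintegral dirichletMeasure_ae_mem_cube n
    (div_nonneg (Finset.prod_nonneg fun i _ => Real.Gamma_nonneg_of_nonneg (by
      have := hm i; positivity)) (Real.Gamma_nonneg_of_nonneg (add_nonneg
        (Finset.sum_nonneg fun i _ => (hm i).le) (by positivity))))
    (lintegral_prod_pow_dirichletMeasure hL hm n)

theorem integral_prod_pow_solidDirichletMeasure (hL : 0 < L) (hm : ∀ i, 0 < m i)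
    (n : Fin L → ℕ) :
    ∫ w, ∏ i, w i ^ n i ∂solidDirichletMeasure m =
      (∏ i, Real.Gamma (m i + n i)) / Real.Gamma (1 + ∑ i, m i + ∑ i, (n i : ℝ)) :=
  integral_prod_pow_of_lintegral solidDirichletMeasure_ae_mem_cube n
    (div_nonneg (Finset.prod_nonneg fun i _ => Real.Gamma_nonneg_of_nonneg (by
      have := hm i; positivity)) (Real.Gamma_nonneg_of_nonneg (add_nonneg (add_nonneg zero_le_one
        (Finset.sum_nonneg fun i _ => (hm i).le)) (by positivity))))
    (lintegral_prod_pow_solidDirichletMeasure hL hm n)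

end

/-! ### Multiple series: products, binomial series, divergence -/

/-- Absolute convergence is carried along because multiplying two sums in the induction step
requires it of the remaining factors. -/
theorem hasSum_fin_pi_prod {L : ℕ} (f : Fin L → ℕ → ℂ) (hf : ∀ i, Summable fun k => ‖f i k‖) :
    (Summable fun n : Fin L → ℕ => ‖∏ i, f i (n i)‖) ∧
      HasSum (fun n : Fin L → ℕ => ∏ i, f i (n i)) (∏ i, ∑' k, f i k) := by
  induction L with
  | zero => exact ⟨Summable.of_finite, by simp⟩
  | succ L ih =>
    obtain ⟨ih1, ih2⟩ := ih (fun i => f i.succ) fun i => hf _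
    let e : ℕ × (Fin L → ℕ) ≃ (Fin (L + 1) → ℕ) := Fin.consEquiv fun _ => ℕ
    have he : ∀ p : ℕ × (Fin L → ℕ), ∏ i, f i (e p i) = f 0 p.1 * ∏ i, f (Fin.succ i) (p.2 i) := by
      intro p
      rw [Fin.prod_univ_succ]
      simp [e, Fin.consEquiv]
    have hs := (hf 0).mul_norm ih1
    refine ⟨(e.summable_iff).1 ?_, (e.hasSum_iff).1 ?_⟩
    · simpa only [Function.comp_def, he] using hs
    · simp only [Function.comp_def, he]
      rw [Fin.prod_univ_succ]
      have := (hf 0).of_norm.hasSum.mul ih2 hs.of_norm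
      exact this

/-- The binomial series of `(1 - z) ^ (-a)`, with its absolute convergence. -/
theorem hasSum_one_sub_cpow_neg (a : ℝ) {z : ℂ} (hz : ‖z‖ < 1) :
    (Summable fun k : ℕ => ‖(((ascPochhammer ℝ k).eval a : ℝ) : ℂ) * (z ^ k / (k.factorial : ℂ))‖) ∧
      HasSum (fun k : ℕ => (((ascPochhammer ℝ k).eval a : ℝ) : ℂ) * (z ^ k / (k.factorial : ℂ)))
        ((1 - z) ^ (-(a : ℂ))) := by
  have h := Complex.one_div_one_sub_cpow_hasFPowerSeriesOnBall_zero (a : ℂ)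
  have hmem : z ∈ Metric.eball (0 : ℂ) 1 := by
    rw [← ENNReal.ofReal_one, Metric.eball_ofReal]; simpa using hz
  have hterm : ∀ k : ℕ, (FormalMultilinearSeries.ofScalars ℂ
      fun n ↦ Ring.choose ((a : ℂ) + n - 1) n) k (fun _ => z) =
      (((ascPochhammer ℝ k).eval a : ℝ) : ℂ) * (z ^ k / (k.factorial : ℂ)) := by
    intro k
    have h1 : (k.factorial : ℂ) * Ring.choose ((a : ℂ) + k - 1) k = (ascPochhammer ℂ k).eval (a : ℂ) := by
      have := Ring.factorial_nsmul_multichoose_eq_ascPochhammer (a : ℂ) k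
      rw [Polynomial.ascPochhammer_smeval_eq_eval, nsmul_eq_mul, Ring.multichoose_eq] at this
      exact this
    have h2 : (((ascPochhammer ℝ k).eval a : ℝ) : ℂ) = (ascPochhammer ℂ k).eval (a : ℂ) := by
      rw [← ascPochhammer_map Complex.ofRealHom, Polynomial.eval_map]
      exact Polynomial.hom_eval₂ _ (RingHom.id ℝ) Complex.ofRealHom a
    rw [h2, ← h1]
    have : (k.factorial : ℂ) ≠ 0 := by exact_mod_cast k.factorial_ne_zero
    simp
    field_simp
  constructor
  · have := FormalMultilinearSeries.summable_norm_apply _ (Metric.eball_subset_eball h.r_le hmem)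
    simpa only [hterm] using this
  · have := h.hasSum hmem
    simpa only [hterm, zero_add, one_div, Complex.cpow_neg] using this

/-- A summable family stays summable on the multi-indices `Pi.single l k`. There it is a Gauss
hypergeometric series in `x l`, whose term ratio tends to `‖x l‖ > 1`. In `ℂ`, `Summable` amounts to
absolute convergence. -/
theorem not_summable_lauricellaFBTerm {L : ℕ} {a b : Fin L → ℝ} {c : ℝ} (ha : ∀ i, 0 < a i)
    (hb : ∀ i, 0 < b i) (hc : 0 < c) {x : Fin L → ℂ} (hx : ∃ i, 1 < ‖x i‖) :
    ¬ Summable (lauricellaFBTerm a b c x) := by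
  obtain ⟨l, hl⟩ := hx
  intro hsum
  have hinj : Function.Injective fun k : ℕ => (Pi.single l k : Fin L → ℕ) :=
    Pi.single_injective (M := fun _ => ℕ) l
  have hsub := hsum.comp_injective hinj
  have hterm : ∀ k : ℕ, lauricellaFBTerm a b c x (Pi.single l k) =
      (((ascPochhammer ℝ k).eval (a l) * (ascPochhammer ℝ k).eval (b l)
        / (ascPochhammer ℝ k).eval c : ℝ) : ℂ) * (x l ^ k / (k.factorial : ℂ)) := by
    intro k
    unfold lauricellaFBTerm
    rw [Finset.prod_eq_single l, Finset.prod_eq_single l, Finset.sum_pi_single']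
    · simp
    all_goals simp +contextual [Pi.single_eq_of_ne]
  simp only [Function.comp_def, hterm] at hsub
  have hpos : ∀ (k : ℕ) {q : ℝ}, 0 < q → 0 < (ascPochhammer ℝ k).eval q :=
    fun k q hq => ascPochhammer_pos k q hq
  have hxl : x l ≠ 0 := by
    intro h; rw [h, norm_zero] at hl; linarith
  refine not_summable_of_ratio_test_tendsto_gt_one hl ?_ hsub
  have hratio : ∀ k : ℕ, ‖(((ascPochhammer ℝ (k + 1)).eval (a l) * (ascPochhammer ℝ (k + 1)).eval (b l)
        / (ascPochhammer ℝ (k + 1)).eval c : ℝ) : ℂ) * (x l ^ (k + 1) / ((k + 1).factorial : ℂ))‖ /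
      ‖(((ascPochhammer ℝ k).eval (a l) * (ascPochhammer ℝ k).eval (b l)
        / (ascPochhammer ℝ k).eval c : ℝ) : ℂ) * (x l ^ k / (k.factorial : ℂ))‖ =
      (a l + k) / (c + k) * ((b l + k) / (1 + k)) * ‖x l‖ := by
    intro k
    have h1 := hpos k (ha l)
    have h2 := hpos k (hb l)
    have h3 := hpos k hc
    have ha' := ha l
    have hb' := hb l
    have hn : 0 < ‖x l‖ := norm_pos_iff.2 hxl
    have hf : (0 : ℝ) < k.factorial := by exact_mod_cast k.factorial_pos
    simp only [ascPochhammer_succ_eval, norm_mul, norm_div, norm_pow, Complex.norm_real,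
      Real.norm_eq_abs, Nat.factorial_succ, Complex.norm_natCast, Nat.cast_mul]
    rw [abs_of_pos h1, abs_of_pos h2, abs_of_pos h3, abs_of_pos (by positivity : 0 < a l + (k : ℝ)),
      abs_of_pos (by positivity : 0 < b l + (k : ℝ)), abs_of_pos (by positivity : 0 < c + (k : ℝ))]
    rw [show ((k + 1 : ℕ) : ℝ) = 1 + (k : ℝ) by push_cast; ring]
    field_simp
    ring
  simp only [hratio]
  have hlim : ∀ p q : ℝ, Filter.Tendsto (fun k : ℕ => (p + k) / (q + k)) Filter.atTop (nhds 1) := by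
    intro p q
    have := tendsto_add_mul_div_add_mul_atTop_nhds p q (1 : ℝ) one_ne_zero
    simpa using this
  simpa using ((hlim (a l) c).mul (hlim (b l) 1)).mul_const ‖x l‖

/-! ### Integral representation of Lauricella functions -/

/-- The kernel `∏ (1 - uᵢ xᵢ) ^ (-aᵢ)` of the integral representations of Lauricella functions. -/
def lauricellaKernel {L : ℕ} (a : Fin L → ℝ) (u : Fin L → ℝ) (x : Fin L → ℂ) : ℂ :=
  ∏ i, (1 - (u i : ℂ) * x i) ^ (-(a i : ℂ))

/-- The slit plane is star-shaped about `1`, and `1 - t z = (1 - t) * 1 + t * (1 - z)`. Hence, for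
`u` in the cube, the kernel is holomorphic on the whole of `lauricellaFBDomain`. -/
theorem one_sub_mul_mem_slitPlane {t : ℝ} (ht : t ∈ Set.Icc (0 : ℝ) 1) {z : ℂ}
    (hz : 1 - z ∈ Complex.slitPlane) : 1 - (t : ℂ) * z ∈ Complex.slitPlane := by
  have := Complex.starConvex_one_slitPlane hz (a := 1 - t) (b := t) (by linarith [ht.2]) ht.1
    (by ring)
  convert this using 1
  simp only [Complex.real_smul]
  push_cast
  ring

theorem isOpen_lauricellaFBDomain (L : ℕ) : IsOpen (lauricellaFBDomain L) := by
  rw [lauricellaFBDomain, Set.ofPred_forall]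
  exact isOpen_iInter_of_finite fun i => Complex.isOpen_slitPlane.preimage (by fun_prop)

theorem continuousOn_one_sub_mul_cpow {L : ℕ} (i : Fin L) (r : ℂ) :
    ContinuousOn (fun p : (Fin L → ℝ) × (Fin L → ℂ) => (1 - (p.1 i : ℂ) * p.2 i) ^ r)
      (Set.Icc 0 1 ×ˢ lauricellaFBDomain L) :=
  ContinuousOn.cpow (by fun_prop) continuousOn_const fun p hp =>
    one_sub_mul_mem_slitPlane ⟨hp.1.1 i, hp.1.2 i⟩ (hp.2 i)

theorem continuousOn_lauricellaKernel {L : ℕ} (a : Fin L → ℝ) :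
    ContinuousOn (fun p : (Fin L → ℝ) × (Fin L → ℂ) => lauricellaKernel a p.1 p.2)
      (Set.Icc 0 1 ×ˢ lauricellaFBDomain L) :=
  continuousOn_finsetProd _ fun i _ => continuousOn_one_sub_mul_cpow i _

/-- The derivative of `lauricellaKernel` in its second variable. -/
def lauricellaKernelDeriv {L : ℕ} (a : Fin L → ℝ) (u : Fin L → ℝ) (x : Fin L → ℂ) :
    (Fin L → ℂ) →L[ℂ] ℂ :=
  ∑ i, (∏ j ∈ Finset.univ.erase i, (1 - (u j : ℂ) * x j) ^ (-(a j : ℂ))) •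
    ((-(a i : ℂ) * (1 - (u i : ℂ) * x i) ^ (-(a i : ℂ) - 1) * -(u i : ℂ)) •
      ContinuousLinearMap.proj (R := ℂ) (φ := fun _ : Fin L => ℂ) i)

theorem continuousOn_lauricellaKernelDeriv {L : ℕ} (a : Fin L → ℝ) :
    ContinuousOn (fun p : (Fin L → ℝ) × (Fin L → ℂ) => lauricellaKernelDeriv a p.1 p.2)
      (Set.Icc 0 1 ×ˢ lauricellaFBDomain L) := by
  refine continuousOn_finsetSum _ fun i _ => ContinuousOn.smul
    (continuousOn_finsetProd _ fun j _ => continuousOn_one_sub_mul_cpow j _) ?_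
  refine ContinuousOn.smul (ContinuousOn.mul (ContinuousOn.mul continuousOn_const
    (continuousOn_one_sub_mul_cpow i _)) (by fun_prop)) continuousOn_const

theorem hasFDerivAt_lauricellaKernel {L : ℕ} (a : Fin L → ℝ) {u : Fin L → ℝ}
    (hu : u ∈ Set.Icc 0 1) {x : Fin L → ℂ} (hx : x ∈ lauricellaFBDomain L) :
    HasFDerivAt (lauricellaKernel a u) (lauricellaKernelDeriv a u x) x := by
  refine HasFDerivAt.finsetProd fun i _ => ?_
  have h1 : HasDerivAt (fun z : ℂ => (1 - (u i : ℂ) * z) ^ (-(a i : ℂ)))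
      (-(a i : ℂ) * (1 - (u i : ℂ) * x i) ^ (-(a i : ℂ) - 1) * -(u i : ℂ)) (x i) := by
    refine HasDerivAt.cpow_const ?_ (one_sub_mul_mem_slitPlane ⟨hu.1 i, hu.2 i⟩ (hx i))
    simpa using ((hasDerivAt_id (x i)).const_mul (u i : ℂ)).const_sub 1
  exact h1.comp_hasFDerivAt x
    (ContinuousLinearMap.proj (R := ℂ) (φ := fun _ : Fin L => ℂ) i).hasFDerivAt

theorem continuousOn_lauricellaKernel_left {L : ℕ} (a : Fin L → ℝ) {x : Fin L → ℂ}
    (hx : x ∈ lauricellaFBDomain L) :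
    ContinuousOn (fun u => lauricellaKernel a u x) (Set.Icc 0 1) :=
  (continuousOn_lauricellaKernel a).comp (f := fun u => (u, x)) (by fun_prop) fun _ hu => ⟨hu, hx⟩

theorem Gamma_add_natCast_eq {q : ℝ} (hq : 0 < q) (n : ℕ) :
    Real.Gamma (q + n) = Real.Gamma q * (ascPochhammer ℝ n).eval q := by
  induction n with
  | zero => simp
  | succ n ih =>
    rw [Nat.cast_succ, ← add_assoc, Real.Gamma_add_one (by positivity), ih, ascPochhammer_succ_eval]
    ring

section

variable {L : ℕ} {ρ : Measure (Fin L → ℝ)}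

theorem aestronglyMeasurable_of_continuousOn_cube {E : Type*} [NormedAddCommGroup E]
    (hρ : ∀ᵐ u ∂ρ, u ∈ Set.Icc 0 1) {g : (Fin L → ℝ) → E} (hg : ContinuousOn g (Set.Icc 0 1)) :
    AEStronglyMeasurable g ρ := by
  rw [← Measure.restrict_eq_self_of_ae_mem hρ]
  exact hg.aestronglyMeasurable measurableSet_Icc

variable [IsFiniteMeasure ρ]

theorem integrable_of_continuousOn_cube {E : Type*} [NormedAddCommGroup E]
    (hρ : ∀ᵐ u ∂ρ, u ∈ Set.Icc 0 1) {g : (Fin L → ℝ) → E} (hg : ContinuousOn g (Set.Icc 0 1)) :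
    Integrable g ρ := by
  obtain ⟨M, hM⟩ := isCompact_Icc.exists_bound_of_continuousOn hg
  exact Integrable.of_bound (aestronglyMeasurable_of_continuousOn_cube hρ hg) M
    (hρ.mono fun u hu => hM u hu)

theorem differentiableOn_integral_lauricellaKernel (a : Fin L → ℝ)
    (hρ : ∀ᵐ u ∂ρ, u ∈ Set.Icc 0 1) :
    DifferentiableOn ℂ (fun x => ∫ u, lauricellaKernel a u x ∂ρ) (lauricellaFBDomain L) := by
  intro x₀ hx₀
  obtain ⟨r, hr, hball⟩ := Metric.nhds_basis_closedBall.mem_iff.1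
    ((isOpen_lauricellaFBDomain L).mem_nhds hx₀)
  -- Joint continuity of the derivative on a compact set gives a constant dominating function,
  -- integrable because `ρ` is finite.
  obtain ⟨M, hM⟩ := (isCompact_Icc.prod (isCompact_closedBall x₀ r)).exists_bound_of_continuousOn
    ((continuousOn_lauricellaKernelDeriv a).mono (Set.prod_mono_right hball))
  refine (hasFDerivAt_integral_of_dominated_of_fderiv_le (bound := fun _ => M)
    (F := fun x u => lauricellaKernel a u x) (F' := fun x u => lauricellaKernelDeriv a u x)
    (Metric.closedBall_mem_nhds x₀ hr) ?_ ?_ ?_ ?_ (integrable_const M)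
    ?_).differentiableAt.differentiableWithinAt
  · filter_upwards [(isOpen_lauricellaFBDomain L).mem_nhds hx₀] with x hx
    exact aestronglyMeasurable_of_continuousOn_cube hρ (continuousOn_lauricellaKernel_left a hx)
  · exact integrable_of_continuousOn_cube hρ (continuousOn_lauricellaKernel_left a hx₀)
  · exact aestronglyMeasurable_of_continuousOn_cube hρ
      ((continuousOn_lauricellaKernelDeriv a).comp (f := fun u => (u, x₀)) (by fun_prop)
        fun _ hu => ⟨hu, hx₀⟩)
  · filter_upwards [hρ] with u hu x hx using hM (u, x) ⟨hu, hx⟩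
  · filter_upwards [hρ] with u hu x hx using hasFDerivAt_lauricellaKernel a hu (hball hx)

/-- The kernel is a product of binomial series. On the cube its terms are bounded by those at `u =
1`, so it may be integrated termwise, and the moments supply `(bᵢ)_{nᵢ}` and `(c)_{∑ nᵢ}`. The
prefactor is the inverse of the mass of `ρ` (the case `n = 0` of `hmom`). -/
theorem hasSum_integral_lauricellaKernel {a b : Fin L → ℝ} {c : ℝ} (hb : ∀ i, 0 < b i) (hc : 0 < c)
    (hρ : ∀ᵐ u ∂ρ, u ∈ Set.Icc 0 1)
    (hmom : ∀ n : Fin L → ℕ, ∫ u, ∏ i, u i ^ n i ∂ρ =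
      (∏ i, Real.Gamma (b i + n i)) / Real.Gamma (c + ∑ i, (n i : ℝ)))
    {x : Fin L → ℂ} (hx : ∀ i, ‖x i‖ < 1) :
    HasSum (lauricellaFBTerm a b c x)
      (((Real.Gamma c / ∏ i, Real.Gamma (b i) : ℝ) : ℂ) * ∫ u, lauricellaKernel a u x ∂ρ) := by
  set T : (Fin L → ℕ) → ℂ := fun n =>
    ∏ i, (((ascPochhammer ℝ (n i)).eval (a i) : ℝ) : ℂ) * (x i ^ n i / ((n i).factorial : ℂ)) with hT
  have hTsum : Summable fun n => ‖T n‖ :=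
    (hasSum_fin_pi_prod _ fun i => (hasSum_one_sub_cpow_neg (a i) (hx i)).1).1
  set F : (Fin L → ℕ) → (Fin L → ℝ) → ℂ := fun n u => T n * ((∏ i, u i ^ n i : ℝ) : ℂ) with hF
  have hFsum : ∀ u ∈ Set.Icc (0 : Fin L → ℝ) 1, HasSum (fun n => F n u) (lauricellaKernel a u x) := by
    intro u hu
    have hux : ∀ i, ‖(u i : ℂ) * x i‖ < 1 := by
      intro i
      rw [norm_mul, Complex.norm_real, Real.norm_eq_abs, abs_of_nonneg (hu.1 i)]
      have h1 : u i ≤ 1 := hu.2 i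
      nlinarith [norm_nonneg (x i), hx i]
    have := (hasSum_fin_pi_prod _ fun i => (hasSum_one_sub_cpow_neg (a i) (hux i)).1).2
    simp only [fun i => (hasSum_one_sub_cpow_neg (a i) (hux i)).2.tsum_eq] at this
    have hfun : (fun n => F n u) = fun n => ∏ i, (((ascPochhammer ℝ (n i)).eval (a i) : ℝ) : ℂ) *
        (((u i : ℂ) * x i) ^ n i / ((n i).factorial : ℂ)) := by
      funext n
      simp only [hF, hT]
      push_cast
      rw [← Finset.prod_mul_distrib]
      exact Finset.prod_congr rfl fun i _ => by ring
    rw [hfun]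
    exact this
  have hFint : ∀ n, Integrable (F n) ρ := fun n =>
    integrable_of_continuousOn_cube hρ (by fun_prop)
  have hFnorm : ∀ n, ∫ u, ‖F n u‖ ∂ρ ≤ ‖T n‖ * ρ.real Set.univ := by
    intro n
    rw [mul_comm, ← smul_eq_mul, ← integral_const]
    refine integral_mono_ae (hFint n).norm (integrable_const _) ?_
    filter_upwards [hρ] with u hu
    rw [hF, norm_mul, Complex.norm_real, Real.norm_eq_abs,
      abs_of_nonneg (Finset.prod_nonneg fun i _ => pow_nonneg (hu.1 i) _)]
    exact mul_le_of_le_one_right (norm_nonneg _)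
      (Finset.prod_le_one (fun i _ => pow_nonneg (hu.1 i) _) fun i _ => pow_le_one₀ (hu.1 i) (hu.2 i))
  have hs := hasSum_integral_of_summable_integral_norm hFint
    ((hTsum.mul_right (ρ.real Set.univ)).of_nonneg_of_le
      (fun n => integral_nonneg fun u => norm_nonneg _) hFnorm)
  rw [integral_congr_ae (hρ.mono fun u hu => (hFsum u hu).tsum_eq)] at hs
  have hG : ∀ i, Real.Gamma (b i) ≠ 0 := fun i => (Real.Gamma_pos_of_pos (hb i)).ne'
  have hGc : Real.Gamma c ≠ 0 := (Real.Gamma_pos_of_pos hc).ne'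
  have hfun : lauricellaFBTerm a b c x = fun n =>
      ((Real.Gamma c / ∏ i, Real.Gamma (b i) : ℝ) : ℂ) * ∫ u, F n u ∂ρ := by
    funext n
    have hcn : (ascPochhammer ℝ (∑ i, n i)).eval c ≠ 0 := (ascPochhammer_pos _ _ hc).ne'
    have hint : ∫ u, F n u ∂ρ = T n *
        (((∏ i, Real.Gamma (b i + n i)) / Real.Gamma (c + ∑ i, (n i : ℝ)) : ℝ) : ℂ) := by
      rw [hF, integral_const_mul, integral_complex_ofReal, hmom]
    have hreal : Real.Gamma c / (∏ i, Real.Gamma (b i)) *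
        ((∏ i, Real.Gamma (b i + n i)) / Real.Gamma (c + ∑ i, (n i : ℝ))) =
        (∏ i, (ascPochhammer ℝ (n i)).eval (b i)) / (ascPochhammer ℝ (∑ i, n i)).eval c := by
      rw [← Nat.cast_sum, Gamma_add_natCast_eq hc]
      simp only [Gamma_add_natCast_eq (hb _), Finset.prod_mul_distrib]
      have := Finset.prod_ne_zero_iff.2 fun i (_ : i ∈ Finset.univ) => hG i
      field_simp
    rw [hint, mul_left_comm, ← Complex.ofReal_mul, hreal]
    simp only [hT, lauricellaFBTerm, Finset.prod_mul_distrib]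
    push_cast
    ring
  rw [hfun]
  exact hs.mul_left _

/-- A finite measure on the cube with the moments of a Dirichlet distribution represents a
Lauricella function. -/
theorem isLauricellaFB_integral_lauricellaKernel {a b : Fin L → ℝ} {c : ℝ} (hb : ∀ i, 0 < b i)
    (hc : 0 < c) (hρ : ∀ᵐ u ∂ρ, u ∈ Set.Icc 0 1)
    (hmom : ∀ n : Fin L → ℕ, ∫ u, ∏ i, u i ^ n i ∂ρ =
      (∏ i, Real.Gamma (b i + n i)) / Real.Gamma (c + ∑ i, (n i : ℝ))) :
    IsLauricellaFB a b c fun x =>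
      ((Real.Gamma c / ∏ i, Real.Gamma (b i) : ℝ) : ℂ) * ∫ u, lauricellaKernel a u x ∂ρ where
  hasSum _ hx := hasSum_integral_lauricellaKernel hb hc hρ hmom hx
  differentiableOn := (differentiableOn_integral_lauricellaKernel a hρ).const_mul _

end

/-- Any witness rules out the default value `0` in the definition by choice. -/
theorem IsLauricellaFB.isLauricellaFB_lauricellaFB {L : ℕ} {a b : Fin L → ℝ} {c : ℝ}
    {F : (Fin L → ℂ) → ℂ} (hF : IsLauricellaFB a b c F) :
    IsLauricellaFB a b c (lauricellaFB a b c) := by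
  have h : ∃ F, IsLauricellaFB a b c F := ⟨F, hF⟩
  rw [lauricellaFB, dif_pos h]
  exact h.choose_spec

/-! ### Fisher–Snedecor laws and their joint density -/

/-- The density of the Fisher–Snedecor distribution with respect to `powMeasure m`. -/
def fisherSnedecorFactor (γbar m ms t : ℝ) : ℝ :=
  (m / (ms * γbar)) ^ m * (Real.Gamma (m + ms) / Real.Gamma ms) / Real.Gamma m *
    (1 + m / (ms * γbar) * t) ^ (-(m + ms))

theorem measurable_fisherSnedecorFactor (γbar m ms : ℝ) :
    Measurable (fisherSnedecorFactor γbar m ms) := by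
  unfold fisherSnedecorFactor
  fun_prop

theorem fisherSnedecorFactor_nonneg {γbar m ms t : ℝ} (hγ : 0 < γbar) (hm : 0 < m) (hms : 0 < ms)
    (ht : 0 ≤ t) : 0 ≤ fisherSnedecorFactor γbar m ms t := by
  have h1 := Real.Gamma_pos_of_pos hm
  have h2 := Real.Gamma_pos_of_pos hms
  have h3 := Real.Gamma_pos_of_pos (add_pos hm hms)
  unfold fisherSnedecorFactor
  positivity

theorem fisherSnedecorPDF_of_pos {γbar m ms t : ℝ} (hγ : 0 < γbar) (hm : 0 < m) (hms : 0 < ms)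
    (ht : 0 < t) :
    fisherSnedecorPDF γbar m ms t = t ^ (m - 1) * fisherSnedecorFactor γbar m ms t := by
  have h1 := Real.Gamma_pos_of_pos hm
  have h2 := Real.Gamma_pos_of_pos hms
  have h3 := Real.Gamma_pos_of_pos (add_pos hm hms)
  have hd : 0 < ms * γbar := mul_pos hms hγ
  have h4 : m * t + ms * γbar = (ms * γbar) * (1 + m / (ms * γbar) * t) := by field_simp; ring
  rw [fisherSnedecorPDF, if_pos ht, fisherSnedecorFactor, beta, h4,
    Real.mul_rpow hd.le (by positivity), Real.rpow_add hd, Real.rpow_neg (by positivity),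
    Real.div_rpow hm.le hd.le]
  have h5 : 0 < (ms * γbar) ^ m := by positivity
  have h6 : 0 < (ms * γbar) ^ ms := by positivity
  have h7 : 0 < (1 + m / (ms * γbar) * t) ^ (m + ms) := by positivity
  -- The real powers become atoms; what remains is an identity of rational expressions.
  generalize (1 + m / (ms * γbar) * t) ^ (m + ms) = z at h7
  generalize (ms * γbar) ^ m = y at h5
  generalize (ms * γbar) ^ ms = w at h6
  field_simp

theorem fisherSnedecorMeasure_eq {γbar m ms : ℝ} (hγ : 0 < γbar) (hm : 0 < m) (hms : 0 < ms) :
    fisherSnedecorMeasure γbar m ms = (powMeasure m).withDensity fun t =>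
      ENNReal.ofReal (fisherSnedecorFactor γbar m ms t) := by
  have hmeas := measurable_fisherSnedecorFactor γbar m ms
  rw [powMeasure, ← withDensity_mul _ (by fun_prop) (by fun_prop),
    ← withDensity_indicator measurableSet_Ioi, fisherSnedecorMeasure]
  congr 1
  funext t
  by_cases ht : 0 < t
  · rw [Set.indicator_of_mem (Set.mem_Ioi.2 ht), Pi.mul_apply,
      ← ENNReal.ofReal_mul (by positivity), fisherSnedecorPDF_of_pos hγ hm hms ht]
  · rw [Set.indicator_of_notMem (show t ∉ Set.Ioi 0 from ht), fisherSnedecorPDF, if_neg ht,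
      ENNReal.ofReal_zero]

section

variable {L : ℕ} {γbar m ms : Fin L → ℝ}

theorem measurable_prod_fisherSnedecorFactor :
    Measurable fun u : Fin L → ℝ =>
      ∏ i, ENNReal.ofReal (fisherSnedecorFactor (γbar i) (m i) (ms i) (u i)) :=
  Finset.measurable_prod _ fun i _ => ENNReal.measurable_ofReal.comp
    ((measurable_fisherSnedecorFactor _ _ _).comp (measurable_pi_apply i))

/-- Independence makes the joint law a product, hence a product density against `piPowMeasure`. The
indicator depends on `∑ uᵢ` alone, as polar coordinates require. -/
theorem map_sum_fisherSnedecor_apply (hγbar : ∀ i, 0 < γbar i) (hm : ∀ i, 0 < m i)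
    (hms : ∀ i, 0 < ms i) {Ω : Type*} [MeasurableSpace Ω] {P : Measure Ω} [IsProbabilityMeasure P]
    {γ : Fin L → Ω → ℝ}
    (hlaw : ∀ i, HasLaw (γ i) (fisherSnedecorMeasure (γbar i) (m i) (ms i)) P)
    (hindep : iIndepFun γ P) {A : Set ℝ} (hA : MeasurableSet A) :
    P.map (fun ω => ∑ i, γ i ω) A = ∫⁻ u, A.indicator 1 (∑ i, u i) *
      ∏ i, ENNReal.ofReal (fisherSnedecorFactor (γbar i) (m i) (ms i) (u i))
        ∂piPowMeasure m := by
  have hae : ∀ i, AEMeasurable (γ i) P := fun i => (hlaw i).aemeasurable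
  have hvec : P.map (fun ω i => γ i ω) = (piPowMeasure m).withDensity fun u =>
      ∏ i, ENNReal.ofReal (fisherSnedecorFactor (γbar i) (m i) (ms i) (u i)) := by
    have hσ : ∀ i, SigmaFinite ((powMeasure (m i)).withDensity fun t =>
        ENNReal.ofReal (fisherSnedecorFactor (γbar i) (m i) (ms i) t)) :=
      fun i => SigmaFinite.withDensity_ofReal _
    rw [(iIndepFun_iff_map_fun_eq_pi_map hae).1 hindep, piPowMeasure,
      ← pi_withDensity (fun i t => ENNReal.ofReal (fisherSnedecorFactor (γbar i) (m i) (ms i) t))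
        fun i => ENNReal.measurable_ofReal.comp (measurable_fisherSnedecorFactor _ _ _)]
    congr 1
    funext i
    rw [(hlaw i).map_eq, fisherSnedecorMeasure_eq (hγbar i) (hm i) (hms i)]
  have hsum : P.map (fun ω => ∑ i, γ i ω) = (P.map fun ω i => γ i ω).map fun u => ∑ i, u i :=
    (AEMeasurable.map_map_of_aemeasurable (g := fun u : Fin L → ℝ => ∑ i, u i)
      (Measurable.aemeasurable (by fun_prop))
      (aemeasurable_pi_lambda _ hae)).symm
  have hmA : MeasurableSet ((fun u : Fin L → ℝ => ∑ i, u i) ⁻¹' A) := hA.preimage (by fun_prop)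
  rw [hsum, Measure.map_apply (by fun_prop) hA, hvec, withDensity_apply _ hmA,
    ← lintegral_indicator hmA]
  refine lintegral_congr fun u => ?_
  by_cases hu : ∑ i, u i ∈ A
  · rw [Set.indicator_of_mem (show u ∈ (fun u : Fin L → ℝ => ∑ i, u i) ⁻¹' A from hu),
      Set.indicator_of_mem hu, Pi.one_apply, one_mul]
  · rw [Set.indicator_of_notMem (show u ∉ (fun u : Fin L → ℝ => ∑ i, u i) ⁻¹' A from hu),
      Set.indicator_of_notMem hu, zero_mul]

theorem continuousOn_prod_fisherSnedecorFactor_smul (hγbar : ∀ i, 0 < γbar i) (hm : ∀ i, 0 < m i)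
    (hms : ∀ i, 0 < ms i) {t : ℝ} (ht : 0 ≤ t) :
    ContinuousOn (fun w : Fin L → ℝ =>
      ∏ i, fisherSnedecorFactor (γbar i) (m i) (ms i) ((t • w) i)) (Set.Icc 0 1) := by
  refine continuousOn_finsetProd _ fun i _ => continuousOn_const.mul ?_
  refine ContinuousOn.rpow_const (by simp only [Pi.smul_apply, smul_eq_mul]; fun_prop)
    fun w hw => Or.inl ?_
  have h1 := hγbar i
  have h2 := hm i
  have h3 := hms i
  have h4 : 0 ≤ w i := hw.1 i
  simp only [Pi.smul_apply, smul_eq_mul]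
  positivity

variable {ρ : Measure (Fin L → ℝ)} [IsFiniteMeasure ρ]

theorem prod_fisherSnedecorFactor_smul_nonneg (hγbar : ∀ i, 0 < γbar i) (hm : ∀ i, 0 < m i)
    (hms : ∀ i, 0 < ms i) {t : ℝ} (ht : 0 ≤ t) {w : Fin L → ℝ} (hw : w ∈ Set.Icc 0 1) (i : Fin L) :
    0 ≤ fisherSnedecorFactor (γbar i) (m i) (ms i) ((t • w) i) :=
  fisherSnedecorFactor_nonneg (hγbar i) (hm i) (hms i) (mul_nonneg ht (hw.1 i))

theorem lintegral_prod_fisherSnedecorFactor_smul (hγbar : ∀ i, 0 < γbar i) (hm : ∀ i, 0 < m i)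
    (hms : ∀ i, 0 < ms i) (hρ : ∀ᵐ u ∂ρ, u ∈ Set.Icc 0 1) {t : ℝ} (ht : 0 ≤ t) :
    ∫⁻ w, ∏ i, ENNReal.ofReal (fisherSnedecorFactor (γbar i) (m i) (ms i) ((t • w) i)) ∂ρ =
      ENNReal.ofReal (∫ w, ∏ i, fisherSnedecorFactor (γbar i) (m i) (ms i) ((t • w) i) ∂ρ) := by
  rw [ofReal_integral_eq_lintegral_ofReal (integrable_of_continuousOn_cube hρ
    (continuousOn_prod_fisherSnedecorFactor_smul hγbar hm hms ht))]
  · refine lintegral_congr_ae (hρ.mono fun w hw => ?_)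
    exact (ENNReal.ofReal_prod_of_nonneg fun i _ =>
      prod_fisherSnedecorFactor_smul_nonneg hγbar hm hms ht hw i).symm
  · exact hρ.mono fun w hw => Finset.prod_nonneg fun i _ =>
      prod_fisherSnedecorFactor_smul_nonneg hγbar hm hms ht hw i

/-- At these arguments `1 - wᵢ xᵢ` is a positive real, so the complex kernel is the real product of
powers. The factors `1 / Γ(mᵢ)` of the densities cancel the `Γ(mᵢ)` in the normalization of the
representation. -/
theorem ofReal_integral_prod_fisherSnedecorFactor_smul (hγbar : ∀ i, 0 < γbar i)
    (hm : ∀ i, 0 < m i) (hms : ∀ i, 0 < ms i) (hρ : ∀ᵐ u ∂ρ, u ∈ Set.Icc 0 1) {c : ℝ} (hc : 0 < c)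
    (hmom : ∀ n : Fin L → ℕ, ∫ u, ∏ i, u i ^ n i ∂ρ =
      (∏ i, Real.Gamma (m i + n i)) / Real.Gamma (c + ∑ i, (n i : ℝ))) {t : ℝ} (ht : 0 ≤ t) :
    ((∫ w, ∏ i, fisherSnedecorFactor (γbar i) (m i) (ms i) ((t • w) i) ∂ρ : ℝ) : ℂ) =
      ((1 / Real.Gamma c * ∏ i, (m i / (ms i * γbar i)) ^ m i *
        (Real.Gamma (m i + ms i) / Real.Gamma (ms i)) : ℝ) : ℂ) *
      lauricellaFB (fun i => m i + ms i) m c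
        (fun i => ((-m i / (ms i * γbar i) * t : ℝ) : ℂ)) := by
  set x : Fin L → ℂ := fun i => ((-m i / (ms i * γbar i) * t : ℝ) : ℂ) with hx
  have hF := isLauricellaFB_integral_lauricellaKernel (a := fun i => m i + ms i) hm hc hρ hmom
  have hxd : x ∈ lauricellaFBDomain L := by
    intro i
    have h1 := hγbar i
    have h2 := hm i
    have h3 := hms i
    have h4 : (1 - x i : ℂ) = ((1 + m i / (ms i * γbar i) * t : ℝ) : ℂ) := by
      simp only [hx]; push_cast; ring
    rw [h4]
    exact Complex.ofReal_mem_slitPlane.2 (by positivity)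
  -- Uniqueness of the continuation is what covers large `t`, where the series is unavailable.
  rw [hF.isLauricellaFB_lauricellaFB.eqOn hF hxd, ← integral_complex_ofReal]
  have hint : ∫ w, ((∏ i, fisherSnedecorFactor (γbar i) (m i) (ms i) ((t • w) i) : ℝ) : ℂ) ∂ρ =
      ∫ w, ((∏ i, ((m i / (ms i * γbar i)) ^ m i * (Real.Gamma (m i + ms i) / Real.Gamma (ms i)) /
        Real.Gamma (m i)) : ℝ) : ℂ) * lauricellaKernel (fun i => m i + ms i) w x ∂ρ := by
    refine integral_congr_ae (hρ.mono fun w hw => ?_)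
    simp only [lauricellaKernel, fisherSnedecorFactor, Finset.prod_mul_distrib, Complex.ofReal_mul]
    congr 1
    rw [Complex.ofReal_prod]
    refine Finset.prod_congr rfl fun i _ => ?_
    have h1 := hγbar i
    have h2 := hm i
    have h3 := hms i
    have h4 : 0 ≤ w i := hw.1 i
    rw [Complex.ofReal_cpow (by simp only [Pi.smul_apply, smul_eq_mul]; positivity)]
    congr 1
    · simp only [hx, Pi.smul_apply, smul_eq_mul]; push_cast; ring
    · push_cast; ring
  rw [hint, integral_const_mul, ← mul_assoc, ← Complex.ofReal_mul]
  congr 2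
  have hG : ∏ i, Real.Gamma (m i) ≠ 0 :=
    Finset.prod_ne_zero_iff.2 fun i _ => (Real.Gamma_pos_of_pos (hm i)).ne'
  have hGc : Real.Gamma c ≠ 0 := (Real.Gamma_pos_of_pos hc).ne'
  rw [Finset.prod_div_distrib]
  field_simp

end

theorem isLauricellaFB_lauricellaFB_of_pos {L : ℕ} (hL : 0 < L) (a : Fin L → ℝ) {m : Fin L → ℝ}
    (hm : ∀ i, 0 < m i) :
    IsLauricellaFB a m (∑ i, m i) (lauricellaFB a m (∑ i, m i)) ∧
      IsLauricellaFB a m (1 + ∑ i, m i) (lauricellaFB a m (1 + ∑ i, m i)) := by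
  have : NeZero L := ⟨hL.ne'⟩
  have hS : 0 < ∑ i, m i := Finset.sum_pos (fun i _ => hm i) Finset.univ_nonempty
  have := isFiniteMeasure_dirichletMeasure hm
  have := isFiniteMeasure_solidDirichletMeasure hm
  exact ⟨(isLauricellaFB_integral_lauricellaKernel hm hS dirichletMeasure_ae_mem_cube
      (integral_prod_pow_dirichletMeasure hL hm)).isLauricellaFB_lauricellaFB,
    (isLauricellaFB_integral_lauricellaKernel hm (by positivity) solidDirichletMeasure_ae_mem_cube
      (integral_prod_pow_solidDirichletMeasure hL hm)).isLauricellaFB_lauricellaFB⟩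

/-! ### Law and distribution function of the sum -/

section

variable {L : ℕ} {γbar m ms : Fin L → ℝ} {Ω : Type*} [MeasurableSpace Ω] {P : Measure Ω}
  [IsProbabilityMeasure P] {γ : Fin L → Ω → ℝ}

theorem hasLaw_sum_fisherSnedecor (hL : 0 < L) (hγbar : ∀ i, 0 < γbar i) (hm : ∀ i, 0 < m i)
    (hms : ∀ i, 0 < ms i)
    (hlaw : ∀ i, HasLaw (γ i) (fisherSnedecorMeasure (γbar i) (m i) (ms i)) P)
    (hindep : iIndepFun γ P) :
    HasLaw (fun ω => ∑ i, γ i ω) (volume.withDensity fun t => ENNReal.ofReal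
      (if t < 0 then 0 else t ^ (∑ i, m i - 1) *
        ∫ w, ∏ i, fisherSnedecorFactor (γbar i) (m i) (ms i) ((t • w) i) ∂dirichletMeasure m))
      P where
  aemeasurable := Finset.aemeasurable_fun_sum _ fun i _ => (hlaw i).aemeasurable
  map_eq := by
    have := isFiniteMeasure_dirichletMeasure hm
    ext A hA
    rw [map_sum_fisherSnedecor_apply hγbar hm hms hlaw hindep hA,
      lintegral_piPowMeasure_polar hL hm measurable_prod_fisherSnedecorFactor
        (measurable_one.indicator hA), withDensity_apply _ hA, lintegral_powMeasure,
      ← lintegral_indicator measurableSet_Ioi, ← lintegral_indicator hA]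
    · refine lintegral_congr_ae ?_
      -- The stated density uses its formula at `t = 0` as well, whereas `powMeasure` lives on `Ioi
      -- 0`; the point is null.
      filter_upwards [compl_mem_ae_iff.2 (measure_singleton (0 : ℝ))] with t ht
      rcases lt_or_gt_of_ne ht with h | h
      · simp [h, h.le, Set.indicator]
      · rw [Set.indicator_of_mem (Set.mem_Ioi.2 h), lintegral_prod_fisherSnedecorFactor_smul hγbar
          hm hms dirichletMeasure_ae_mem_cube h.le]
        by_cases htA : t ∈ A
        · rw [Set.indicator_of_mem htA, Set.indicator_of_mem htA, if_neg h.not_gt,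
            ENNReal.ofReal_mul (by positivity), Pi.one_apply, one_mul]
        · simp [htA]
    · refine Measurable.mul (measurable_one.indicator hA) ?_
      exact Measurable.lintegral_prod_right' (f := fun p : ℝ × (Fin L → ℝ) =>
        ∏ i, ENNReal.ofReal (fisherSnedecorFactor (γbar i) (m i) (ms i) ((p.1 • p.2) i)))
        (measurable_prod_fisherSnedecorFactor.comp (by fun_prop))

/-- The density is not integrated: dilation by `x` carries `{∑ uᵢ ≤ 1}` to `{∑ uᵢ ≤ x}` and produces
the factor `x ^ S`. -/
theorem cdf_sum_fisherSnedecor (hL : 0 < L) (hγbar : ∀ i, 0 < γbar i) (hm : ∀ i, 0 < m i)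
    (hms : ∀ i, 0 < ms i)
    (hlaw : ∀ i, HasLaw (γ i) (fisherSnedecorMeasure (γbar i) (m i) (ms i)) P)
    (hindep : iIndepFun γ P) {x : ℝ} (hx : 0 ≤ x) :
    cdf (P.map fun ω => ∑ i, γ i ω) x = x ^ (∑ i, m i) *
      ∫ w, ∏ i, fisherSnedecorFactor (γbar i) (m i) (ms i) ((x • w) i)
        ∂solidDirichletMeasure m := by
  have : NeZero L := ⟨hL.ne'⟩
  have hS : 0 < ∑ i, m i := Finset.sum_pos (fun i _ => hm i) Finset.univ_nonempty
  have := isFiniteMeasure_solidDirichletMeasure hm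
  have : IsProbabilityMeasure (P.map fun ω => ∑ i, γ i ω) := Measure.isProbabilityMeasure_map
    (Finset.aemeasurable_fun_sum _ fun i _ => (hlaw i).aemeasurable)
  rw [cdf_eq_real, measureReal_def,
    map_sum_fisherSnedecor_apply hγbar hm hms hlaw hindep measurableSet_Iic]
  -- Dilation needs `x > 0`. At `x = 0` both sides vanish, since the coordinates are almost
  -- everywhere positive and `S > 0`.
  rcases hx.eq_or_lt with rfl | hx
  · rw [Real.zero_rpow hS.ne', zero_mul, ENNReal.toReal_eq_zero_iff]
    left
    rw [← lintegral_zero (μ := piPowMeasure m)]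
    refine lintegral_congr_ae ?_
    filter_upwards [piPowMeasure_ae_pos m] with u hu
    have : 0 < ∑ i, u i := Finset.sum_pos (fun i _ => hu i) Finset.univ_nonempty
    rw [Set.indicator_of_notMem (by simpa using this), zero_mul]
  · have hmeas : Measurable fun u : Fin L → ℝ =>
        (Set.Iic x).indicator (1 : ℝ → ENNReal) (∑ i, u i) *
        ∏ i, ENNReal.ofReal (fisherSnedecorFactor (γbar i) (m i) (ms i) (u i)) :=
      Measurable.mul ((measurable_one.indicator measurableSet_Iic).comp (by fun_prop))
        measurable_prod_fisherSnedecorFactor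
    rw [lintegral_piPowMeasure_smul m hx hmeas]
    have hsolid : ∫⁻ u, (Set.Iic x).indicator (1 : ℝ → ENNReal) (∑ i, (x • u) i) *
        ∏ i, ENNReal.ofReal (fisherSnedecorFactor (γbar i) (m i) (ms i) ((x • u) i))
          ∂piPowMeasure m = ∫⁻ u, ∏ i, ENNReal.ofReal
          (fisherSnedecorFactor (γbar i) (m i) (ms i) ((x • u) i)) ∂solidDirichletMeasure m := by
      rw [solidDirichletMeasure, ← lintegral_indicator (measurableSet_sum_le 1)]
      refine lintegral_congr fun u => ?_
      have h1 : ∑ i, (x • u) i ≤ x ↔ ∑ i, u i ≤ 1 := by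
        simp only [Pi.smul_apply, smul_eq_mul, ← Finset.mul_sum]
        exact mul_le_iff_le_one_right hx
      by_cases hu : ∑ i, u i ≤ 1
      · rw [Set.indicator_of_mem (Set.mem_Iic.2 (h1.2 hu)), Pi.one_apply, one_mul,
          Set.indicator_of_mem (show u ∈ {u : Fin L → ℝ | ∑ i, u i ≤ 1} from hu)]
      · rw [Set.indicator_of_notMem (show ∑ i, (x • u) i ∉ Set.Iic x from fun h => hu (h1.1 h)),
          zero_mul,
          Set.indicator_of_notMem (show u ∉ {u : Fin L → ℝ | ∑ i, u i ≤ 1} from hu)]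
    rw [hsolid, lintegral_prod_fisherSnedecorFactor_smul hγbar hm hms
      solidDirichletMeasure_ae_mem_cube hx.le, ← ENNReal.ofReal_mul (by positivity),
      ENNReal.toReal_ofReal]
    refine mul_nonneg (by positivity) (integral_nonneg_of_ae ?_)
    filter_upwards [solidDirichletMeasure_ae_mem_cube] with w hw
    exact Finset.prod_nonneg fun i _ =>
      prod_fisherSnedecorFactor_smul_nonneg hγbar hm hms hx.le hw i

end

end

/-! ### PDF, CDF and region of convergence -/

theorem proposition1 {Ω : Type*} [MeasurableSpace Ω] (P : Measure Ω) [IsProbabilityMeasure P]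
    (L : ℕ) (hL : 1 ≤ L) (γbar m ms : Fin L → ℝ)
    (hγbar : ∀ ℓ, 0 < γbar ℓ) (hm : ∀ ℓ, 0 < m ℓ) (hms : ∀ ℓ, 0 < ms ℓ)
    (γ : Fin L → Ω → ℝ)
    (hlaw : ∀ ℓ, HasLaw (γ ℓ) (fisherSnedecorMeasure (γbar ℓ) (m ℓ) (ms ℓ)) P)
    (hindep : iIndepFun γ P) :
    -- the Lauricella functions that occur below exist on `(ℂ ∖ [1, ∞))^L`
    IsLauricellaFB (fun ℓ => m ℓ + ms ℓ) m (∑ ℓ, m ℓ)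
      (lauricellaFB (fun ℓ => m ℓ + ms ℓ) m (∑ ℓ, m ℓ)) ∧
    IsLauricellaFB (fun ℓ => m ℓ + ms ℓ) m (1 + ∑ ℓ, m ℓ)
      (lauricellaFB (fun ℓ => m ℓ + ms ℓ) m (1 + ∑ ℓ, m ℓ)) ∧
    -- the PDF of the sum
    (∃ f : ℝ → ℝ,
      HasLaw (fun ω => ∑ ℓ, γ ℓ ω) (volume.withDensity fun x => ENNReal.ofReal (f x)) P ∧
      (∀ x, 0 ≤ f x) ∧ (∀ x < 0, f x = 0) ∧
      ∀ x, 0 ≤ x →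
        (f x : ℂ) =
          ((x ^ ((∑ ℓ, m ℓ) - 1) / Real.Gamma (∑ ℓ, m ℓ)
            * ∏ ℓ, (m ℓ / (ms ℓ * γbar ℓ)) ^ m ℓ
                * (Real.Gamma (m ℓ + ms ℓ) / Real.Gamma (ms ℓ)) : ℝ) : ℂ)
          * lauricellaFB (fun ℓ => m ℓ + ms ℓ) m (∑ ℓ, m ℓ)
              (fun ℓ => ((-m ℓ / (ms ℓ * γbar ℓ) * x : ℝ) : ℂ))) ∧
    -- the CDF of the sum
    (∀ x, 0 ≤ x →
      (cdf (P.map fun ω => ∑ ℓ, γ ℓ ω) x : ℂ) =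
        ((x ^ (∑ ℓ, m ℓ) / Real.Gamma (1 + ∑ ℓ, m ℓ)
          * ∏ ℓ, (m ℓ / (ms ℓ * γbar ℓ)) ^ m ℓ
              * (Real.Gamma (m ℓ + ms ℓ) / Real.Gamma (ms ℓ)) : ℝ) : ℂ)
        * lauricellaFB (fun ℓ => m ℓ + ms ℓ) m (1 + ∑ ℓ, m ℓ)
            (fun ℓ => ((-m ℓ / (ms ℓ * γbar ℓ) * x : ℝ) : ℂ))) ∧
    -- both series converge, to the values used above, if every argument is less than 1 in modulus
    (∀ x, 0 ≤ x → (∀ ℓ, |m ℓ / (ms ℓ * γbar ℓ) * x| < 1) →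
      HasSum
        (lauricellaFBTerm (fun ℓ => m ℓ + ms ℓ) m (∑ ℓ, m ℓ)
          (fun ℓ => ((-m ℓ / (ms ℓ * γbar ℓ) * x : ℝ) : ℂ)))
        (lauricellaFB (fun ℓ => m ℓ + ms ℓ) m (∑ ℓ, m ℓ)
          (fun ℓ => ((-m ℓ / (ms ℓ * γbar ℓ) * x : ℝ) : ℂ))) ∧
      HasSum
        (lauricellaFBTerm (fun ℓ => m ℓ + ms ℓ) m (1 + ∑ ℓ, m ℓ)
          (fun ℓ => ((-m ℓ / (ms ℓ * γbar ℓ) * x : ℝ) : ℂ)))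
        (lauricellaFB (fun ℓ => m ℓ + ms ℓ) m (1 + ∑ ℓ, m ℓ)
          (fun ℓ => ((-m ℓ / (ms ℓ * γbar ℓ) * x : ℝ) : ℂ)))) ∧
    -- and neither converges if some argument is greater than 1 in modulus
    (∀ x, 0 ≤ x → (∃ ℓ, 1 < |m ℓ / (ms ℓ * γbar ℓ) * x|) →
      ¬ Summable
        (lauricellaFBTerm (fun ℓ => m ℓ + ms ℓ) m (∑ ℓ, m ℓ)
          (fun ℓ => ((-m ℓ / (ms ℓ * γbar ℓ) * x : ℝ) : ℂ))) ∧
      ¬ Summable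
        (lauricellaFBTerm (fun ℓ => m ℓ + ms ℓ) m (1 + ∑ ℓ, m ℓ)
          (fun ℓ => ((-m ℓ / (ms ℓ * γbar ℓ) * x : ℝ) : ℂ)))) := by
  have hL0 : 0 < L := hL
  have : NeZero L := ⟨hL0.ne'⟩
  have hS : 0 < ∑ ℓ, m ℓ := Finset.sum_pos (fun i _ => hm i) Finset.univ_nonempty
  have := isFiniteMeasure_dirichletMeasure hm
  have := isFiniteMeasure_solidDirichletMeasure hm
  obtain ⟨hF0, hF1⟩ := isLauricellaFB_lauricellaFB_of_pos hL0 (fun ℓ => m ℓ + ms ℓ) hm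
  have hnorm : ∀ ℓ x, ‖((-m ℓ / (ms ℓ * γbar ℓ) * x : ℝ) : ℂ)‖ = |m ℓ / (ms ℓ * γbar ℓ) * x| := by
    intro ℓ x
    rw [Complex.norm_real, Real.norm_eq_abs, neg_div, neg_mul, abs_neg]
  refine ⟨hF0, hF1, ⟨_, hasLaw_sum_fisherSnedecor hL0 hγbar hm hms hlaw hindep, ?_, ?_, ?_⟩,
    ?_, ?_, ?_⟩
  · intro x
    split_ifs with hx
    · exact le_rfl
    · rw [not_lt] at hx
      refine mul_nonneg (by positivity) (integral_nonneg_of_ae ?_)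
      filter_upwards [dirichletMeasure_ae_mem_cube] with w hw
      exact Finset.prod_nonneg fun i _ =>
        prod_fisherSnedecorFactor_smul_nonneg hγbar hm hms hx hw i
  · intro x hx
    exact if_pos hx
  -- The point `x = 0` needs no separate treatment: both sides carry the same factor `x ^ (S - 1)`.
  · intro x hx
    simp only [if_neg hx.not_gt]
    rw [Complex.ofReal_mul, ofReal_integral_prod_fisherSnedecorFactor_smul hγbar hm hms
      dirichletMeasure_ae_mem_cube hS (integral_prod_pow_dirichletMeasure hL0 hm) hx, ← mul_assoc,
      ← Complex.ofReal_mul]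
    congr 2
    ring
  · intro x hx
    rw [cdf_sum_fisherSnedecor hL0 hγbar hm hms hlaw hindep hx, Complex.ofReal_mul,
      ofReal_integral_prod_fisherSnedecorFactor_smul hγbar hm hms
      solidDirichletMeasure_ae_mem_cube (by positivity)
      (integral_prod_pow_solidDirichletMeasure hL0 hm) hx, ← mul_assoc, ← Complex.ofReal_mul]
    congr 2
    ring
  · intro x _ hx
    have hx' : ∀ ℓ, ‖((-m ℓ / (ms ℓ * γbar ℓ) * x : ℝ) : ℂ)‖ < 1 := fun ℓ => by
      rw [hnorm]; exact hx ℓ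
    exact ⟨hF0.hasSum _ hx', hF1.hasSum _ hx'⟩
  · rintro x _ ⟨ℓ, hx⟩
    have hx' : ∃ ℓ, 1 < ‖((-m ℓ / (ms ℓ * γbar ℓ) * x : ℝ) : ℂ)‖ := ⟨ℓ, by rw [hnorm]; exact hx⟩
    have ha : ∀ ℓ, 0 < m ℓ + ms ℓ := fun ℓ => add_pos (hm ℓ) (hms ℓ)
    exact ⟨not_summable_lauricellaFBTerm ha hm hS hx',
      not_summable_lauricellaFBTerm ha hm (by positivity) hx'⟩
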